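/- **Conventions.** $\Sigma$ is a finite alphabet containing two distinct symbols $0,1$; $\Sigma^*$ is the set of finite words and $\Sigma^\omega$ the set of infinite sequences over $\Sigma$. A multi-function $f:A\rightrightarrows B$ is given by sets $f(a)\subseteq B$ $(a\in A)$, with $\mathrm{dom}(f)=\{a: f(a)\neq\emptyset\}$; a partial function is a multi-function with at most one value at each point. A generalized multi-representation is a multi-function $\gamma:X\rightrightarrows Y$ with range $Y$; it is a multi-representation of $Y$ if $X=\Sigma^\omega$. A multi-function $f:X_1\times\dots\times X_n\rightrightarrows X_0$ *realizes* $g:Y_1\times\dots\times Y_n\rightrightarrows Y_0$ via generalized multi-representations $\gamma_i:X_i\rightrightarrows Y_i$ if, whenever $y\in\mathrm{dom}(g)$ and $y_j\in\gamma_j(x_j)$ for $1\le j\le n$, we have $f(x)\neq\emptyset$ and $g(y)\cap\gamma_0(x_0)\neq\emptyset$ for every $x_0\in f(x)$. A partial function from $(\Sigma^\omega)^n$ to $\Sigma^\omega$ (or to $\Sigma^*$) is *computable* if it is extended by the function computed by a Type-2 machine: a Turing machine with $n$ one-way read-only input tapes, finitely many work tapes and a one-way output tape, whose value is the infinite sequence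 it writes while computing forever (respectively, the word on the output tape when it halts). It is *continuous* if it is continuous on its domain, where $\Sigma^\omega$ carries the Cantor topology and $\Sigma^*$ the discrete topology. A multi-function $f:Z_1\times\dots\times Z_n\rightrightarrows Z_0$ is $(\delta_1,\dots,\delta_n,\delta_0)$-computable (continuous), where $\delta_i$ is a multi-representation of $Z_i$, if it is realized via $(\delta_1,\dots,\delta_n,\delta_0)$ by a computable (continuous) partial function from $(\Sigma^\omega)^n$ to $\Sigma^\omega$. A partial function $f$ from $Z_1\times\dots\times Z_n$ to $\Sigma^*$ is $(\delta_1,\dots,\delta_n,\mathrm{id}_{\Sigma^*})$-computable (continuous) if it is realized via $(\delta_1,\dots,\delta_n,\mathrm{id}_{\Sigma^*})$ by a computable (continuous) partial function from $(\Sigma^\omega)^n$ to $\Sigma^*$. **Machines.** A generalized Turing machine $\mathbf P$ has a finite set of labels with an initial label $l_0$ and a final label $l_f$, a finite work alphabet $\Gamma$ with a blank symbol, numbers $k\le L$, and for each tape $i\in\{0,\dots,L\}$ a set $Z_i$ disjoint from $\Gamma$; tapes $1,\dots,k$ are the input tapes and tape $0$ is the output tape. Tapes are two-way infinite, and every cell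 of tape $i$ holds an element of $\Gamma\cup Z_i$. To every label $l\ne l_f$ one statement is attached: move the head of tape $i$ one cell to the right or to the left; write $a\in\Gamma$ under the head of tape $i$; branch according to whether $a\in\Gamma$ is scanned on tape $i$; an assignment $i:=f(i_1,\dots,i_n)$ with a multi-function $f:Z_{i_1}\times\dots\times Z_{i_n}\rightrightarrows Z_i$, which writes any element of $f(x_{i_1},\dots,x_{i_n})$ under the head of tape $i$, where $x_j$ is the symbol scanned on tape $j$; or a test with a partial function $f$ from $Z_{i_1}\times\dots\times Z_{i_n}$ to $\Sigma^*$ with values in $\{0,1\}$, which branches on the value $f(x_{i_1},\dots,x_{i_n})$. After its action each statement goes to a label that it specifies. There is no successor configuration at $l_f$, nor if an assignment or test is applied to arguments that are not in the $Z_{i_j}$ or not in the domain of $f$. Initially the label is $l_0$, all heads are at position $0$, cell $0$ of tape $j$ holds $x_j$ for $1\le j\le k$, and all other cells are blank. A configuration is accepting if its label is $l_f$ and cell $0$ of tape $0$ holds an element of $Z_0$. The multi-function $f_{\mathbf P}:Z_1\times\dots\times Z_k\rightrightarrows Z_0$ is defined by: $x_0\in f_{\mathbf P}(x_1,\dots,x_k)$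 iff every maximal computation from the initial configuration of $(x_1,\dots,x_k)$ is finite and ends in an accepting configuration, and some computation from it ends in an accepting configuration with $x_0$ in cell $0$ of tape $0$. **Theorem.** Let $\mathbf P$ be a generalized Turing machine as above, and for $0\le i\le L$ let $\delta_i:\Sigma^\omega\rightrightarrows Z_i$ be a multi-representation of $Z_i$. 1. If for every assignment $i:=f(i_1,\dots,i_n)$ of $\mathbf P$ the multi-function $f$ is $(\delta_{i_1},\dots,\delta_{i_n},\delta_i)$-computable, and for every test of $\mathbf P$ with partial function $f$ on tapes $i_1,\dots,i_n$ the function $f$ is $(\delta_{i_1},\dots,\delta_{i_n},\mathrm{id}_{\Sigma^*})$-computable, then $f_{\mathbf P}$ is $(\delta_1,\dots,\delta_k,\delta_0)$-computable. 2. The same holds with "continuous" in place of "computable" throughout. -/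

import Mathlib

universe u v s

/-- A multi-function from `A` to `B`, given by its value sets; `a` is in the domain of `f` iff
`f a` is non-empty. -/
abbrev MultiFun (A : Type*) (B : Type*) := A → Set B

/-- A partial function regarded as a multi-function. -/
def PFun.toMultiFun {A B : Type*} (f : A →. B) : MultiFun A B := fun a => {b | b ∈ f a}

/-- `f` realizes `g` via `(γ 0, …, γ (n-1), γ₀)`. -/
def Realizes {n : ℕ} {X Y : Fin n → Type*} {X₀ Y₀ : Type*}
    (γ : ∀ i, MultiFun (X i) (Y i)) (γ₀ : MultiFun X₀ Y₀)
    (f : MultiFun (∀ i, X i) X₀) (g : MultiFun (∀ i, Y i) Y₀) : Prop :=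
  ∀ (x : ∀ i, X i) (y : ∀ i, Y i), (∀ i, y i ∈ γ i (x i)) → (g y).Nonempty →
    (f x).Nonempty ∧ ∀ x₀ ∈ f x, (g y ∩ γ₀ x₀).Nonempty

/-- A multi-representation of `Z`: a multi-function from the infinite sequences over the alphabet
`σ` to `Z` with range `Z`. -/
structure MultiRep (σ : Type s) (Z : Type u) where
  /-- the set of objects named by a sequence -/
  toFun : MultiFun (ℕ → σ) Z
  /-- every object has a name -/
  range_eq : ∀ z, ∃ p, z ∈ toFun p

/-! ### Type-2 machines -/

/-- The instruction attached to a state of a Type-2 machine with alphabet `σ`, `k` input tapes,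
`m` work tapes, work alphabet `Γ` and state set `Q`. The input tapes are read-only and one-way,
the output tape is one-way and write-only. -/
inductive Type2Instr (σ : Type s) (k m : ℕ) (Γ Q : Type)
  /-- halt -/
  | halt
  /-- branch on the symbol scanned by the head of input tape `j` -/
  | inBranch (j : Fin k) (next : σ → Q)
  /-- move the head of input tape `j` one cell to the right -/
  | inRight (j : Fin k) (next : Q)
  /-- branch on the symbol scanned by the head of work tape `i` -/
  | branch (i : Fin m) (next : Γ → Q)
  /-- move the head of work tape `i` one cell to the right -/
  | right (i : Fin m) (next : Q)
  /-- move the head of work tape `i` one cell to the left -/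
  | left (i : Fin m) (next : Q)
  /-- write `a` on the cell scanned by the head of work tape `i` -/
  | write (i : Fin m) (a : Γ) (next : Q)
  /-- write `a` on the output tape and move the output head to the right -/
  | out (a : σ) (next : Q)

/-- A Type-2 machine with `k` input tapes, all of which carry infinite sequences over `σ`. -/
structure Type2Machine (σ : Type s) (k : ℕ) where
  /-- states -/
  Q : Type
  /-- work alphabet -/
  Γ : Type
  finite_Q : Finite Q
  finite_Γ : Finite Γ
  /-- number of work tapes -/
  m : ℕ
  /-- blank symbol -/
  blank : Γ
  /-- initial state -/
  start : Q
  /-- the program -/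
  instr : Q → Type2Instr σ k m Γ Q

namespace Type2Machine

variable {σ : Type s} {k : ℕ}

/-- Configurations: state, input head positions, inscriptions and head positions of the work
tapes, and the word written on the output tape so far. -/
structure Config (M : Type2Machine σ k) where
  state : M.Q
  inPos : Fin k → ℕ
  tape : Fin M.m → ℤ → M.Γ
  head : Fin M.m → ℤ
  output : List σ

/-- The initial configuration. -/
def init (M : Type2Machine σ k) : M.Config where
  state := M.start
  inPos := fun _ => 0
  tape := fun _ _ => M.blank
  head := fun _ => 0
  output := []

/-- One step on input `p`; the value is `none` iff the machine has halted. -/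
def step (M : Type2Machine σ k) (p : Fin k → ℕ → σ) (c : M.Config) : Option M.Config :=
  match M.instr c.state with
  | .halt => none
  | .inBranch j next => some { c with state := next (p j (c.inPos j)) }
  | .inRight j next =>
      some { c with state := next, inPos := Function.update c.inPos j (c.inPos j + 1) }
  | .branch i next => some { c with state := next (c.tape i (c.head i)) }
  | .right i next =>
      some { c with state := next, head := Function.update c.head i (c.head i + 1) }
  | .left i next =>
      some { c with state := next, head := Function.update c.head i (c.head i - 1) }
  | .write i a next =>
      some { c with
        state := next
        tape := Function.update c.tape i (Function.update (c.tape i) (c.head i) a) }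
  | .out a next => some { c with state := next, output := c.output ++ [a] }

/-- The configuration after `n` steps on input `p`, if the machine has not halted before. -/
def run (M : Type2Machine σ k) (p : Fin k → ℕ → σ) : ℕ → Option M.Config
  | 0 => some M.init
  | n + 1 => (M.run p n).bind (M.step p)

/-- `f_M(p) = w` for the output type of finite words: on input `p` the machine halts with `w` on
the output tape. -/
def YieldsWord (M : Type2Machine σ k) (p : Fin k → ℕ → σ) (w : List σ) : Prop :=
  ∃ n c, M.run p n = some c ∧ M.step p c = none ∧ c.output = w

/-- `f_M(p) = q` for the output type of infinite sequences: on input `p` the machine computes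
forever and writes `q` on the output tape. -/
def YieldsSeq (M : Type2Machine σ k) (p : Fin k → ℕ → σ) (q : ℕ → σ) : Prop :=
  (∀ n, (M.run p n).isSome) ∧
    ∀ i, ∃ n c, M.run p n = some c ∧ c.output[i]? = some (q i)

end Type2Machine

/-! ### Computable and continuous functions on sequences -/

section Functions

variable {σ : Type s} {n : ℕ}

/-- A partial function from `n`-tuples of sequences to sequences is computable iff it is extended
by the function of some Type-2 machine. -/
def ComputableToSeq (g : (Fin n → ℕ → σ) →. (ℕ → σ)) : Prop :=
  ∃ M : Type2Machine σ n, ∀ p, ∀ q ∈ g p, M.YieldsSeq p q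

/-- A partial function from `n`-tuples of sequences to words is computable iff it is extended by
the function of some Type-2 machine. -/
def ComputableToWord (g : (Fin n → ℕ → σ) →. List σ) : Prop :=
  ∃ M : Type2Machine σ n, ∀ p, ∀ q ∈ g p, M.YieldsWord p q

/-- Continuity, on its domain, of a partial function from tuples of sequences to sequences, where
sequences carry the Cantor topology (the product of discrete topologies). -/
def ContinuousToSeq (g : (Fin n → ℕ → σ) →. (ℕ → σ)) : Prop :=
  letI : TopologicalSpace σ := ⊥
  Continuous g.asSubtype

/-- Continuity, on its domain, of a partial function from tuples of sequences to words, where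
the set of words is discrete. -/
def ContinuousToWord (g : (Fin n → ℕ → σ) →. List σ) : Prop :=
  letI : TopologicalSpace σ := ⊥
  @Continuous g.Dom (List σ) inferInstance ⊥ g.asSubtype

variable {Y : Fin n → Type u} {Y₀ : Type v}

/-- `f` is `(δ 0, …, δ (n-1), δ₀)`-computable: it has a computable realization. -/
def RelComputable (δ : ∀ j, MultiRep σ (Y j)) (δ₀ : MultiRep σ Y₀)
    (f : MultiFun (∀ j, Y j) Y₀) : Prop :=
  ∃ g : (Fin n → ℕ → σ) →. (ℕ → σ), ComputableToSeq g ∧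
    Realizes (fun j => (δ j).toFun) δ₀.toFun g.toMultiFun f

/-- `f` is `(δ 0, …, δ (n-1), δ₀)`-continuous: it has a continuous realization. -/
def RelContinuous (δ : ∀ j, MultiRep σ (Y j)) (δ₀ : MultiRep σ Y₀)
    (f : MultiFun (∀ j, Y j) Y₀) : Prop :=
  ∃ g : (Fin n → ℕ → σ) →. (ℕ → σ), ContinuousToSeq g ∧
    Realizes (fun j => (δ j).toFun) δ₀.toFun g.toMultiFun f

/-- The word-valued partial function `f` is `(δ 0, …, δ (n-1), id)`-computable, where `id` is the
identity notation of the set of words. -/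
def RelWordComputable (δ : ∀ j, MultiRep σ (Y j)) (f : (∀ j, Y j) →. List σ) : Prop :=
  ∃ g : (Fin n → ℕ → σ) →. List σ, ComputableToWord g ∧
    Realizes (fun j => (δ j).toFun) (fun x : List σ => {x}) g.toMultiFun f.toMultiFun

/-- The word-valued partial function `f` is `(δ 0, …, δ (n-1), id)`-continuous, where `id` is the
identity notation of the set of words. -/
def RelWordContinuous (δ : ∀ j, MultiRep σ (Y j)) (f : (∀ j, Y j) →. List σ) : Prop :=
  ∃ g : (Fin n → ℕ → σ) →. List σ, ContinuousToWord g ∧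
    Realizes (fun j => (δ j).toFun) (fun x : List σ => {x}) g.toMultiFun f.toMultiFun

end Functions

/-! ### Generalized Turing machines -/

/-- Statements of a generalized Turing machine with tapes `0, …, L`, tape sets `X i`, work alphabet
`Γ` and labels `Lab`; `zero` and `one` are the symbols `0` and `1` of the alphabet `σ`. -/
inductive GTMStmt (σ : Type s) (zero one : σ) {L : ℕ} (X : Fin (L + 1) → Type u)
    (Γ Lab : Type v)
  /-- `(i, right, l')` -/
  | right (i : Fin (L + 1)) (l' : Lab)
  /-- `(i, left, l')` -/
  | left (i : Fin (L + 1)) (l' : Lab)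
  /-- `(i := a, l')` -/
  | write (i : Fin (L + 1)) (a : Γ) (l' : Lab)
  /-- `(i, if a then l', else l'')` -/
  | branch (i : Fin (L + 1)) (a : Γ) (l' l'' : Lab)
  /-- `(i := f(i₁, …, iₙ), l')` -/
  | assign {n : ℕ} (i : Fin (L + 1)) (idx : Fin n → Fin (L + 1))
      (f : MultiFun (∀ j, X (idx j)) (X i)) (l' : Lab)
  /-- `(if f(i₁, …, iₙ) then l', else l'')`, where `f` has values in `{0, 1}` -/
  | test {n : ℕ} (idx : Fin n → Fin (L + 1)) (f : (∀ j, X (idx j)) →. List σ)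
      (hf : ∀ x, ∀ y ∈ f x, y = [zero] ∨ y = [one]) (l' l'' : Lab)

/-- A generalized Turing machine with tapes `0, …, L` carrying the sets `X i`, of which tapes
`1, …, k` are the input tapes and tape `0` is the output tape. -/
structure GTM (σ : Type s) (zero one : σ) (k : ℕ) {L : ℕ} (X : Fin (L + 1) → Type u) where
  /-- labels -/
  Lab : Type v
  /-- work alphabet -/
  Γ : Type v
  finite_Lab : Finite Lab
  finite_Γ : Finite Γ
  k_le : k ≤ L
  /-- initial label -/
  l₀ : Lab
  /-- final label -/
  lf : Lab
  /-- blank symbol -/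
  blank : Γ
  /-- the statement of a non-final label -/
  stm : ∀ l : Lab, l ≠ lf → GTMStmt σ zero one X Γ Lab

namespace GTM

variable {σ : Type s} {zero one : σ} {k L : ℕ} {X : Fin (L + 1) → Type u}

/-- The number of the `j`-th input tape: for `j = 0, …, k - 1` this is tape `j + 1`. -/
def inTape (P : GTM.{u, v, s} σ zero one k X) (j : Fin k) : Fin (L + 1) :=
  ⟨j.val + 1, by have := P.k_le; omega⟩

/-- Configurations. Every cell of tape `i` contains an element of the disjoint union of `Γ` and
`X i`. -/
structure Config (P : GTM.{u, v, s} σ zero one k X) where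
  label : P.Lab
  tape : ∀ i : Fin (L + 1), ℤ → P.Γ ⊕ X i
  head : Fin (L + 1) → ℤ

/-- The content of the cell scanned by the head of tape `i`. -/
def Config.scan {P : GTM.{u, v, s} σ zero one k X} (c : P.Config) (i : Fin (L + 1)) :
    P.Γ ⊕ X i :=
  c.tape i (c.head i)

/-- Replace the label. -/
def Config.goto {P : GTM.{u, v, s} σ zero one k X} (c : P.Config) (l : P.Lab) : P.Config :=
  { c with label := l }

/-- Move the head of tape `i` to position `m`. -/
def Config.setHead {P : GTM.{u, v, s} σ zero one k X} (c : P.Config) (i : Fin (L + 1))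
    (m : ℤ) : P.Config :=
  { c with head := Function.update c.head i m }

/-- Write `y` under the head of tape `i`. -/
def Config.setCell {P : GTM.{u, v, s} σ zero one k X} (c : P.Config) (i : Fin (L + 1))
    (y : P.Γ ⊕ X i) : P.Config :=
  { c with tape := Function.update c.tape i (Function.update (c.tape i) (c.head i) y) }

/-- The effect of a statement: `c'` is a possible successor of `c`. -/
def Effect (P : GTM.{u, v, s} σ zero one k X) (c c' : P.Config) :
    GTMStmt σ zero one X P.Γ P.Lab → Prop
  | .right i l' => c' = (c.setHead i (c.head i + 1)).goto l'
  | .left i l' => c' = (c.setHead i (c.head i - 1)).goto l'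
  | .write i a l' => c' = (c.setCell i (Sum.inl a)).goto l'
  | .branch i a l' l'' =>
      (c.scan i = Sum.inl a ∧ c' = c.goto l') ∨ (c.scan i ≠ Sum.inl a ∧ c' = c.goto l'')
  | .assign i idx f l' =>
      ∃ x : ∀ j, X (idx j), (∀ j, c.scan (idx j) = Sum.inr (x j)) ∧
        ∃ y ∈ f x, c' = (c.setCell i (Sum.inr y)).goto l'
  | .test idx f _ l' l'' =>
      ∃ x : ∀ j, X (idx j), (∀ j, c.scan (idx j) = Sum.inr (x j)) ∧
        (([zero] ∈ f x ∧ c' = c.goto l') ∨ ([one] ∈ f x ∧ c' = c.goto l''))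

/-- The successor relation on configurations. -/
def Step (P : GTM.{u, v, s} σ zero one k X) (c c' : P.Config) : Prop :=
  ∃ h : c.label ≠ P.lf, P.Effect c c' (P.stm c.label h)

/-- Accepting configurations. -/
def Accepting (P : GTM.{u, v, s} σ zero one k X) (c : P.Config) : Prop :=
  c.label = P.lf ∧ ∃ x : X 0, c.tape 0 0 = Sum.inr x

/-- The initial configuration: cell `0` of the `j`-th input tape contains `x j`, all other cells
are blank, and all heads are on position `0`. -/
def initial (P : GTM.{u, v, s} σ zero one k X) (x : ∀ j, X (P.inTape j)) : P.Config where
  label := P.l₀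
  tape := fun i m =>
    if h : m = 0 ∧ 0 < i.val ∧ i.val ≤ k then
      Sum.inr (cast
        (congrArg X (Fin.ext (Nat.sub_add_cancel h.2.1) :
          P.inTape ⟨i.val - 1, by omega⟩ = i))
        (x ⟨i.val - 1, by omega⟩))
    else Sum.inl P.blank
  head := fun _ => 0

/-- Every maximal computation with first configuration `c₀` is accepting: there is no infinite
computation from `c₀`, and the last configuration of every finite computation from `c₀` that cannot
be continued is accepting. -/
def AllAccepting (P : GTM.{u, v, s} σ zero one k X) (c₀ : P.Config) : Prop :=
  (¬ ∃ κ : ℕ → P.Config, κ 0 = c₀ ∧ ∀ n, P.Step (κ n) (κ (n + 1))) ∧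
    ∀ c, Relation.ReflTransGen P.Step c₀ c → (¬ ∃ c', P.Step c c') → P.Accepting c

/-- The multi-function computed by the machine. -/
def fn (P : GTM.{u, v, s} σ zero one k X) : MultiFun (∀ j, X (P.inTape j)) (X 0) := fun x =>
  {x₀ | P.AllAccepting (P.initial x) ∧
    ∃ c, Relation.ReflTransGen P.Step (P.initial x) c ∧ P.Accepting c ∧
      c.tape 0 0 = Sum.inr x₀}

/-- The machine is `(δ i)`-computable: every multi-function in an assignment and every partial
function in a test is relatively computable. -/
def IsComputable (P : GTM.{u, v, s} σ zero one k X) (δ : ∀ i, MultiRep σ (X i)) : Prop :=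
  ∀ (l : P.Lab) (h : l ≠ P.lf),
    match P.stm l h with
    | .assign i idx f _ => RelComputable (fun j => δ (idx j)) (δ i) f
    | .test idx f _ _ _ => RelWordComputable (fun j => δ (idx j)) f
    | _ => True

/-- The machine is `(δ i)`-continuous: every multi-function in an assignment and every partial
function in a test is relatively continuous. -/
def IsContinuous (P : GTM.{u, v, s} σ zero one k X) (δ : ∀ i, MultiRep σ (X i)) : Prop :=
  ∀ (l : P.Lab) (h : l ≠ P.lf),
    match P.stm l h with
    | .assign i idx f _ => RelContinuous (fun j => δ (idx j)) (δ i) f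
    | .test idx f _ _ _ => RelWordContinuous (fun j => δ (idx j)) f
    | _ => True

end GTM

/-!
Choose realizers of the multi-functions of the machine. On names instead of points the machine then
computes, along every run on a name of `x`, names of the configurations of a run on `x`; so it is
enough to realize the machine whose tapes hold sequences over `σ`.

A partial function `g` on sequences is computable if and only if some primitive recursive `h` maps a
precision `t` and finite prefixes of the arguments to a word such that, wherever `g` is defined,
every word is a prefix of the value of `g` (soundness), and its length tends to infinity with the
precision and the lengths of the prefixes (completeness). Dropping the word "primitive recursive"
gives continuity. Replace the sequences on the tapes by words, the realizers by such
approximations, and run the machine for `t` steps with precision `t`: every step preserves soundness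
and, along the finite run of the machine, completeness. So the machine has such an approximation as
soon as its realizers have.
-/

/-! ### Type-2 programs with an arbitrary state set -/

section FreePrograms

variable {σ : Type s} {k m : ℕ} {Γ Q : Type}

/-- The configurations of a Type-2 program whose state set need not be finite. -/
structure FreeConfig (σ : Type s) (k m : ℕ) (Γ Q : Type) where
  state : Q
  inPos : Fin k → ℕ
  tape : Fin m → ℤ → Γ
  head : Fin m → ℤ
  output : List σ

/-- One step of a Type-2 program whose state set need not be finite; it mirrors
`Type2Machine.step`. -/
def freeStep (instr : Q → Type2Instr σ k m Γ Q) (p : Fin k → ℕ → σ)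
    (c : FreeConfig σ k m Γ Q) : Option (FreeConfig σ k m Γ Q) :=
  match instr c.state with
  | .halt => none
  | .inBranch j next => some { c with state := next (p j (c.inPos j)) }
  | .inRight j next =>
      some { c with state := next, inPos := Function.update c.inPos j (c.inPos j + 1) }
  | .branch i next => some { c with state := next (c.tape i (c.head i)) }
  | .right i next =>
      some { c with state := next, head := Function.update c.head i (c.head i + 1) }
  | .left i next =>
      some { c with state := next, head := Function.update c.head i (c.head i - 1) }
  | .write i a next =>
      some { c with
        state := next
        tape := Function.update c.tape i (Function.update (c.tape i) (c.head i) a) }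
  | .out a next => some { c with state := next, output := c.output ++ [a] }

/-- Reachability in finitely many steps of a program. -/
abbrev FreeReach (instr : Q → Type2Instr σ k m Γ Q) (p : Fin k → ℕ → σ)
    (c c' : FreeConfig σ k m Γ Q) : Prop :=
  Relation.ReflTransGen (fun a b => freeStep instr p a = some b) c c'

/-- The states to which an instruction may lead. -/
def Type2Instr.targets : Type2Instr σ k m Γ Q → Set Q
  | .halt => ∅
  | .inBranch _ next => Set.range next
  | .inRight _ next => {next}
  | .branch _ next => Set.range next
  | .right _ next => {next}
  | .left _ next => {next}
  | .write _ _ next => {next}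
  | .out _ next => {next}

/-- The instruction with renamed target states. -/
def Type2Instr.map {Q' : Type} (f : Q → Q') :
    Type2Instr σ k m Γ Q → Type2Instr σ k m Γ Q'
  | .halt => .halt
  | .inBranch j next => .inBranch j fun x => f (next x)
  | .inRight j next => .inRight j (f next)
  | .branch i next => .branch i fun x => f (next x)
  | .right i next => .right i (f next)
  | .left i next => .left i (f next)
  | .write i a next => .write i a (f next)
  | .out a next => .out a (f next)

theorem Type2Instr.map_ne_halt {Q' : Type} {f : Q → Q'} {I : Type2Instr σ k m Γ Q}
    (hI : I ≠ .halt) : I.map f ≠ .halt := by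
  cases I <;> first | exact absurd rfl hI | exact fun h => nomatch h

theorem Type2Machine.step_eq_none_iff {M : Type2Machine σ k} {p : Fin k → ℕ → σ}
    {c : M.Config} : M.step p c = none ↔ M.instr c.state = .halt := by
  unfold Type2Machine.step
  split <;> simp_all

theorem Type2Machine.isSome_run_of_ne_halt {M : Type2Machine σ k} (hM : ∀ q, M.instr q ≠ .halt)
    (p : Fin k → ℕ → σ) (n : ℕ) : (M.run p n).isSome := by
  induction n with
  | zero => rfl
  | succ n ih =>
    obtain ⟨c, hc⟩ := Option.isSome_iff_exists.1 ih
    rw [Type2Machine.run, hc, Option.bind_some, Option.isSome_iff_ne_none, Ne,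
      Type2Machine.step_eq_none_iff]
    exact hM c.state

open Classical in
/-- The Type-2 machine given by a program on a finite set `S` of states. The program is meant to
stay in `S`; a jump out of `S` is redirected to the initial state. -/
noncomputable def restrictProgram [Finite Γ] (instr : Q → Type2Instr σ k m Γ Q) (blank : Γ)
    (S : Set Q) (hS : S.Finite) (q₀ : S) : Type2Machine σ k where
  Q := S
  Γ := Γ
  finite_Q := hS
  finite_Γ := inferInstance
  m := m
  blank := blank
  start := q₀
  instr := fun q => (instr q).map fun q' => if h : q' ∈ S then ⟨q', h⟩ else q₀

variable [Finite Γ] {instr : Q → Type2Instr σ k m Γ Q} {blank : Γ} {S : Set Q} {hS : S.Finite}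
  {q₀ : S} {p : Fin k → ℕ → σ}

/-- The configuration of the unrestricted program that corresponds to a configuration of
`restrictProgram`. -/
def Type2Machine.Config.toFree (c : (restrictProgram instr blank S hS q₀).Config) :
    FreeConfig σ k m Γ Q :=
  ⟨Subtype.val (p := (· ∈ S)) c.state, c.inPos, c.tape, c.head, c.output⟩

theorem restrictProgram_step (hcl : ∀ q ∈ S, (instr q).targets ⊆ S)
    (c : (restrictProgram instr blank S hS q₀).Config) :
    ((restrictProgram instr blank S hS q₀).step p c).map Type2Machine.Config.toFree =
      freeStep instr p c.toFree := by
  obtain ⟨⟨q, hq⟩, pos, tape, head, out⟩ := c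
  have hq := hcl q hq
  simp only [freeStep, Type2Machine.Config.toFree, Type2Machine.step, restrictProgram]
  cases hi : instr q <;> simp only [hi] at hq <;> simp only [Type2Instr.map, Option.map]
  all_goals
    rw [dif_pos (hq (by first | exact Set.mem_singleton _ | exact ⟨_, rfl⟩))]
    try rfl

theorem restrictProgram_reach (hcl : ∀ q ∈ S, (instr q).targets ⊆ S)
    {d : FreeConfig σ k m Γ Q}
    (h : FreeReach instr p (restrictProgram instr blank S hS q₀).init.toFree d) :
    ∃ n c, (restrictProgram instr blank S hS q₀).run p n = some c ∧ c.toFree = d := by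
  induction h with
  | refl => exact ⟨0, _, rfl, rfl⟩
  | tail _ hs ih =>
    obtain ⟨n, c, hc, rfl⟩ := ih
    obtain ⟨c', hc', rfl⟩ := Option.map_eq_some_iff.1 ((restrictProgram_step hcl c).trans hs)
    exact ⟨n + 1, c', by rw [Type2Machine.run, hc, Option.bind_some, hc'], rfl⟩

theorem restrictProgram_yieldsSeq (hcl : ∀ q ∈ S, (instr q).targets ⊆ S)
    (hhalt : ∀ q ∈ S, instr q ≠ .halt) {q : ℕ → σ}
    (hq : ∀ i, ∃ d, FreeReach instr p ⟨q₀, fun _ => 0, fun _ _ => blank, fun _ => 0, []⟩ d ∧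
      d.output[i]? = some (q i)) :
    (restrictProgram instr blank S hS q₀).YieldsSeq p q := by
  classical
  have hM : ∀ q', (restrictProgram instr blank S hS q₀).instr q' ≠ .halt := fun ⟨q', hq'⟩ =>
    Type2Instr.map_ne_halt (f := fun x => if h : x ∈ S then (⟨x, h⟩ : S) else q₀) (hhalt q' hq')
  refine ⟨Type2Machine.isSome_run_of_ne_halt hM p, fun i => ?_⟩
  obtain ⟨d, hd, hi⟩ := hq i
  obtain ⟨n, c, hc, rfl⟩ := restrictProgram_reach (hS := hS) hcl hd
  exact ⟨n, c, hc, hi⟩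

end FreePrograms

/-! ### Type-2 machines that call partial recursive functions in a loop -/

section StackConfig

open Turing.PartrecToTM2

variable {σ : Type s} {k : ℕ} {Q : Type}

/-- The work tape that stores a stack of the machine `Turing.PartrecToTM2.tr`. -/
def stackTape : K' → Fin 4
  | .main => 0
  | .rev => 1
  | .aux => 2
  | .stack => 3

theorem stackTape_injective : Function.Injective stackTape := by
  intro κ κ' h
  cases κ <;> cases κ' <;> first | rfl | exact absurd h (by decide)

/-- A configuration of a program with four work tapes in which stacks take the place of the work
tapes. -/
structure StackConfig (σ : Type s) (k : ℕ) (Q : Type) where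
  state : Q
  stk : K' → List Γ'
  inPos : Fin k → ℕ
  output : List σ

/-- The work tapes of `d` store the stacks of `c`: the top of a stack is under the head, the other
entries follow to the left, up to the first blank. -/
structure StackConfig.IsStoredIn (c : StackConfig σ k Q) (d : FreeConfig σ k 4 (Option Γ') Q) :
    Prop where
  state : d.state = c.state
  tape : ∀ (κ : K') (i : ℕ),
    d.tape (stackTape κ) (d.head (stackTape κ) - i) = (c.stk κ)[i]?
  inPos : d.inPos = c.inPos
  output : d.output = c.output

/-- From every configuration that stores `c` the program reaches one that stores `c'`. -/
def Leads (instr : Q → Type2Instr σ k 4 (Option Γ') Q) (p : Fin k → ℕ → σ)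
    (c c' : StackConfig σ k Q) : Prop :=
  ∀ d, c.IsStoredIn d → ∃ d', FreeReach instr p d d' ∧ c'.IsStoredIn d'

variable {instr : Q → Type2Instr σ k 4 (Option Γ') Q} {p : Fin k → ℕ → σ}
  {c c' c'' : StackConfig σ k Q} {q q' q'' : Q} {κ : K'} {S : K' → List Γ'} {pos : Fin k → ℕ}
  {out : List σ}

theorem Leads.refl (c : StackConfig σ k Q) : Leads instr p c c := fun d hd => ⟨d, .refl, hd⟩

theorem Leads.trans (h : Leads instr p c c') (h' : Leads instr p c' c'') :
    Leads instr p c c'' := fun d hd => by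
  obtain ⟨d', hdd', hd'⟩ := h d hd
  obtain ⟨d'', hdd'', hd''⟩ := h' d' hd'
  exact ⟨d'', hdd'.trans hdd'', hd''⟩

theorem leads_branch {next : Option Γ' → Q} (hq : instr q = .branch (stackTape κ) next) :
    Leads instr p ⟨q, S, pos, out⟩ ⟨next (S κ).head?, S, pos, out⟩ := by
  rintro d ⟨rfl, hS, rfl, rfl⟩
  have hstep : freeStep instr p d =
      some { d with state := next (d.tape (stackTape κ) (d.head (stackTape κ))) } := by
    simp only [freeStep, hq]
  refine ⟨_, .single hstep, ?_, hS, rfl, rfl⟩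
  simpa [List.head?_eq_getElem?] using congrArg next (hS κ 0)

theorem leads_pop (hq : instr q = .left (stackTape κ) q') :
    Leads instr p ⟨q, S, pos, out⟩ ⟨q', Function.update S κ (S κ).tail, pos, out⟩ := by
  rintro d ⟨rfl, hS, rfl, rfl⟩
  have hstep : freeStep instr p d = some { d with
      state := q'
      head := Function.update d.head (stackTape κ) (d.head (stackTape κ) - 1) } := by
    simp only [freeStep, hq]
  refine ⟨_, .single hstep, rfl, fun κ' i => ?_, rfl, rfl⟩
  by_cases hκ : κ' = κ
  · subst hκ
    simp only [Function.update_self, List.getElem?_tail, ← hS]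
    congr 1
    push_cast
    ring
  · have hκ' : stackTape κ' ≠ stackTape κ := stackTape_injective.ne hκ
    simpa only [Function.update_of_ne hκ, Function.update_of_ne hκ'] using hS κ' i

theorem leads_push {a : Γ'} (hq : instr q = .right (stackTape κ) q')
    (hq' : instr q' = .write (stackTape κ) (some a) q'') :
    Leads instr p ⟨q, S, pos, out⟩ ⟨q'', Function.update S κ (a :: S κ), pos, out⟩ := by
  rintro d ⟨rfl, hS, rfl, rfl⟩
  let d₁ : FreeConfig σ k 4 (Option Γ') Q := { d with
    state := q'
    head := Function.update d.head (stackTape κ) (d.head (stackTape κ) + 1) }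
  have hmove : freeStep instr p d = some d₁ := by simp only [freeStep, hq, d₁]
  have hwrite : freeStep instr p d₁ = some { d₁ with
      state := q''
      tape := Function.update d.tape (stackTape κ)
        (Function.update (d.tape (stackTape κ)) (d.head (stackTape κ) + 1) (some a)) } := by
    simp only [freeStep, hq', d₁, Function.update_self]
  refine ⟨_, .head hmove (.single hwrite), rfl, fun κ' i => ?_, rfl, rfl⟩
  by_cases hκ : κ' = κ
  · subst hκ
    cases i with
    | zero => simp [d₁]
    | succ i =>
      simp only [d₁, Function.update_self, List.getElem?_cons_succ, ← hS]
      rw [Function.update_of_ne (by push_cast; omega)]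
      congr 1
      push_cast
      ring
  · have hκ' : stackTape κ' ≠ stackTape κ := stackTape_injective.ne hκ
    simpa only [d₁, Function.update_of_ne hκ, Function.update_of_ne hκ'] using hS κ' i

theorem leads_out {a : σ} (hq : instr q = .out a q') :
    Leads instr p ⟨q, S, pos, out⟩ ⟨q', S, pos, out ++ [a]⟩ := by
  rintro d ⟨rfl, hS, rfl, rfl⟩
  have hstep : freeStep instr p d = some { d with state := q', output := d.output ++ [a] } := by
    simp only [freeStep, hq]
  exact ⟨_, .single hstep, rfl, hS, rfl, rfl⟩

theorem leads_read {j : Fin k} {next : σ → Q} (hq : instr q = .inBranch j next)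
    (hnext : instr (next (p j (pos j))) = .inRight j q') :
    Leads instr p ⟨q, S, pos, out⟩ ⟨q', S, Function.update pos j (pos j + 1), out⟩ := by
  rintro d ⟨rfl, hS, rfl, rfl⟩
  have hbranch : freeStep instr p d = some { d with state := next (p j (d.inPos j)) } := by
    simp only [freeStep, hq]
  have hmove : freeStep instr p { d with state := next (p j (d.inPos j)) } = some { d with
      state := q'
      inPos := Function.update d.inPos j (d.inPos j + 1) } := by
    simp only [freeStep, hnext]
  exact ⟨_, .head hbranch (.single hmove), rfl, hS, rfl, rfl⟩

end StackConfig

section CodeLoop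

open Turing Turing.PartrecToTM2

/-- The statements of the stack machine `Turing.PartrecToTM2.tr`, which evaluates codes of partial
recursive functions. -/
abbrev CodeStmt := TM2.Stmt (fun _ : K' => Γ') Λ' (Option Γ')

/-- The states of a machine that, in a loop, evaluates a code, writes an output symbol, and reads
one symbol from each input tape. The input alphabet is represented by the type `τ`. -/
inductive LoopState (k : ℕ) (τ : Type) : Type
  /-- execute a statement of the stack machine -/
  | run (q : CodeStmt) (v : Option Γ')
  /-- write a symbol on a stack after moving the head, then continue with `q` -/
  | push (a : Γ') (κ : K') (q : CodeStmt) (v : Option Γ')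
  /-- remove the topmost symbol of a stack, then continue with `q` -/
  | pop (κ : K') (q : CodeStmt) (v : Option Γ')
  /-- collect the symbols of the first number on the main stack -/
  | parse (w : List Γ')
  /-- remove the topmost symbol `a` of the main stack while collecting -/
  | parsed (w : List Γ') (a : Γ')
  /-- write an output symbol -/
  | emit (x : τ)
  /-- read the symbol under the head of input tape `j` -/
  | read (j : Fin k) (r : Fin k → τ)
  /-- move the head of input tape `j` -/
  | move (j : Fin k) (r : Fin k → τ)

/-- The data of a machine that evaluates codes in a loop. The stacks hold lists of numbers; the
first number that results from an evaluation determines the output symbol, the other numbers are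
the arguments of the next evaluation. -/
structure CodeLoop (σ : Type s) (k : ℕ) (τ : Type) where
  /-- the representation of the symbols in states -/
  equiv : σ ≃ τ
  /-- the code to be evaluated if the tuple `r` has been read from the input tapes -/
  code : (Fin k → σ) → ToPartrec.Code
  /-- the output symbol, if any, determined by the representation of a number on the stack -/
  decode : List Γ' → Option σ
  /-- the number of symbols that suffice to represent the first number of a result -/
  maxLength : ℕ

namespace CodeLoop

open LoopState

variable {σ : Type s} {k : ℕ} {τ : Type}

/-- The first state of the evaluation of a code. -/
def start (c : ToPartrec.Code) : LoopState k τ := run (tr (trNormal c .halt)) none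

/-- Read the input tapes from number `j` on, then evaluate the code chosen by the symbols read. -/
def readFrom (P : CodeLoop σ k τ) (j : ℕ) (r : Fin k → τ) : LoopState k τ :=
  if h : j < k then .read ⟨j, h⟩ r else start (P.code fun i => P.equiv.symm (r i))

/-- The states of the loop that occur if the labels of the stack machine are taken from `F`. -/
def Allowed (P : CodeLoop σ k τ) (F : Finset Λ') : LoopState k τ → Prop
  | run q _ => ∃ l ∈ F, q ∈ TM2.stmts₁ (tr l)
  | push _ _ q _ => ∃ l ∈ F, q ∈ TM2.stmts₁ (tr l)
  | pop _ q _ => ∃ l ∈ F, q ∈ TM2.stmts₁ (tr l)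
  | parse w => w.length ≤ P.maxLength
  | parsed w _ => w.length ≤ P.maxLength
  | _ => True

theorem finite_allowed [Finite τ] (P : CodeLoop σ k τ) (F : Finset Λ') :
    {x | P.Allowed F x}.Finite := by
  have : Finite K' := Finite.of_injective _ stackTape_injective
  let T : Set CodeStmt := {q | ∃ l ∈ F, q ∈ TM2.stmts₁ (tr l)}
  have hT : T.Finite :=
    (F.finite_toSet.biUnion fun l _ => (TM2.stmts₁ (tr l)).finite_toSet).subset
      fun q hq => by simpa [T] using hq
  have hTv (f : CodeStmt → Option Γ' → LoopState k τ) : (Set.image2 f T Set.univ).Finite :=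
    hT.image2 f Set.finite_univ
  have hW : {w : List Γ' | w.length ≤ P.maxLength}.Finite := List.finite_length_le Γ' _
  refine ((hTv run).union <| (Set.finite_iUnion fun a =>
    Set.finite_iUnion fun κ => hTv (push a κ)).union <|
    (Set.finite_iUnion fun κ => hTv (pop κ)).union <| (hW.image parse).union <|
    (hW.image2 parsed Set.finite_univ).union <| (Set.finite_range emit).union <|
    (Set.finite_range (Function.uncurry LoopState.read)).union <|
    Set.finite_range (Function.uncurry move)).subset fun x hx => ?_
  cases x <;> simp_all [Allowed, T]

variable {F : Finset Λ'}

theorem allowed_start (P : CodeLoop σ k τ) {c : ToPartrec.Code}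
    (h : codeSupp c Cont'.halt ⊆ F) : P.Allowed F (start c) :=
  ⟨_, h (codeSupp_self _ _ (trStmts₁_self _)), TM2.stmts₁_self⟩

theorem allowed_readFrom {P : CodeLoop σ k τ} (hF : ∀ r, codeSupp (P.code r) Cont'.halt ⊆ F)
    (j : ℕ) (r : Fin k → τ) : P.Allowed F (P.readFrom j r) := by
  unfold readFrom
  split_ifs
  · trivial
  · exact allowed_start P (hF _)

theorem exists_supporting_labels [Finite σ] (P : CodeLoop σ k τ) (c : ToPartrec.Code) :
    ∃ F : Finset Λ', codeSupp c Cont'.halt ⊆ F ∧ (∀ r, codeSupp (P.code r) Cont'.halt ⊆ F) ∧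
      ∀ l ∈ F, TM2.SupportsStmt F (tr l) := by
  classical
  have := Fintype.ofFinite (Fin k → σ)
  let supp := fun r => codeSupp (P.code r) Cont'.halt
  let F := codeSupp c Cont'.halt ∪ Finset.univ.biUnion supp
  have hc : codeSupp c Cont'.halt ⊆ F := Finset.subset_union_left
  have hcode : ∀ r, supp r ⊆ F := fun r =>
    (Finset.subset_biUnion_of_mem supp (Finset.mem_univ r)).trans Finset.subset_union_right
  refine ⟨F, hc, hcode, fun l hl => ?_⟩
  rcases Finset.mem_union.1 hl with hl | hl
  · exact codeSupp_supports hc l hl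
  · obtain ⟨r, -, hr⟩ := Finset.mem_biUnion.1 hl
    exact codeSupp_supports (hcode r) l hr

variable [Inhabited τ]

/-- The state after the first number has been removed from the main stack. -/
def afterParse (P : CodeLoop σ k τ) (w : List Γ') : LoopState k τ :=
  match P.decode w with
  | some x => emit (P.equiv x)
  | none => P.readFrom 0 default

/-- The program of the loop. -/
def instr (P : CodeLoop σ k τ) : LoopState k τ → Type2Instr σ k 4 (Option Γ') (LoopState k τ)
  | run (.push κ f q) v => .right (stackTape κ) (push (f v) κ q v)
  | run (.peek κ f q) v => .branch (stackTape κ) fun x => run q (f v x)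
  | run (.pop κ f q) v => .branch (stackTape κ) fun x =>
      match x with
      | none => run q (f v none)
      | some a => pop κ q (f v (some a))
  | run (.load f q) v => .branch (stackTape .main) fun _ => run q (f v)
  | run (.branch f q₁ q₂) v =>
      .branch (stackTape .main) fun _ => cond (f v) (run q₁ v) (run q₂ v)
  | run (.goto f) v => .branch (stackTape .main) fun _ => run (tr (f v)) v
  | run .halt _ => .branch (stackTape .main) fun _ => parse []
  | push a κ q v => .write (stackTape κ) (some a) (run q v)
  | pop κ q v => .left (stackTape κ) (run q v)
  | parse w => .branch (stackTape .main) fun x =>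
      match x with
      | none => parse w
      | some a => parsed w a
  | parsed w a => .left (stackTape .main)
      (if a = Γ'.cons then P.afterParse w
        else if w.length < P.maxLength then parse (w ++ [a]) else parse w)
  | emit x => .out (P.equiv.symm x) (P.readFrom 0 default)
  | .read j r => .inBranch j fun x => move j (Function.update r j (P.equiv x))
  | move j r => .inRight j (P.readFrom (j + 1) r)

/-- The state that corresponds to a configuration of the stack machine. -/
def ofCfg : TM2.Cfg (fun _ : K' => Γ') Λ' (Option Γ') → LoopState k τ
  | ⟨some l, v, _⟩ => run (tr l) v
  | ⟨none, _, _⟩ => parse []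

/-- The contents of the four stacks when the main stack holds `w` and the others are empty. -/
abbrev mainStack (w : List Γ') : K' → List Γ' := K'.elim w [] [] []

variable {P : CodeLoop σ k τ} {p : Fin k → ℕ → σ} {pos : Fin k → ℕ} {out : List σ}

theorem leads_run (q : CodeStmt) (v : Option Γ') (S : K' → List Γ') :
    Leads P.instr p ⟨run q v, S, pos, out⟩
      ⟨ofCfg (TM2.stepAux q v S), (TM2.stepAux q v S).stk, pos, out⟩ := by
  induction q generalizing v S with
  | push κ f q ih => exact (leads_push (by rfl) (by rfl)).trans (ih v _)
  | peek κ f q ih =>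
    refine (leads_branch (by rfl)).trans ?_
    exact ih _ S
  | pop κ f q ih =>
    refine (leads_branch (by rfl)).trans ?_
    rw [TM2.stepAux]
    cases hκ : S κ with
    | nil =>
      rw [List.tail_nil, ← hκ, Function.update_eq_self, hκ]
      exact ih _ S
    | cons a w =>
      refine (leads_pop (κ := κ) (by rfl)).trans ?_
      rw [hκ]
      exact ih _ _
  | load f q ih =>
    refine (leads_branch (by rfl)).trans ?_
    exact ih _ S
  | branch f q₁ q₂ ih₁ ih₂ =>
    refine (leads_branch (by rfl)).trans ?_
    rw [TM2.stepAux]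
    cases f v
    · exact ih₂ v S
    · exact ih₁ v S
  | goto f =>
    refine (leads_branch (by rfl)).trans ?_
    exact .refl _
  | halt =>
    refine (leads_branch (by rfl)).trans ?_
    exact .refl _

theorem leads_eval {c : ToPartrec.Code} {v v' : List ℕ} (hc : v' ∈ c.eval v) :
    Leads P.instr p ⟨start c, mainStack (trList v), pos, out⟩
      ⟨parse [], mainStack (trList v'), pos, out⟩ := by
  have heval : PartrecToTM2.halt v' ∈
      StateTransition.eval (TM2.step tr) (PartrecToTM2.init c v) := by
    rw [tr_eval]
    exact Part.mem_map _ hc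
  suffices ∀ C, StateTransition.Reaches (TM2.step tr) (PartrecToTM2.init c v) C →
      Leads P.instr p ⟨start c, mainStack (trList v), pos, out⟩ ⟨ofCfg C, C.stk, pos, out⟩ from
    this _ (StateTransition.mem_eval.1 heval).1
  intro C hC
  induction hC with
  | refl => exact .refl _
  | @tail C C' _ hstep ih =>
    obtain ⟨l, v, S⟩ := C
    cases l with
    | none => cases hstep
    | some l =>
      cases hstep
      exact ih.trans (leads_run (tr l) v S)

theorem leads_parsed (w : List Γ') (a : Γ') (l : List Γ') :
    Leads P.instr p ⟨parsed w a, mainStack (a :: l), pos, out⟩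
      ⟨if a = Γ'.cons then P.afterParse w
        else if w.length < P.maxLength then parse (w ++ [a]) else parse w,
        mainStack l, pos, out⟩ := by
  have h : Function.update (mainStack (a :: l)) .main l = mainStack l := by simp
  exact h ▸ leads_pop (κ := .main) (S := mainStack (a :: l)) (by rfl)

theorem leads_parse {w u l : List Γ'} (hu : Γ'.cons ∉ u)
    (hlen : w.length + u.length ≤ P.maxLength) :
    Leads P.instr p ⟨parse w, mainStack (u ++ Γ'.cons :: l), pos, out⟩
      ⟨P.afterParse (w ++ u), mainStack l, pos, out⟩ := by
  induction u generalizing w with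
  | nil =>
    refine (leads_branch (by rfl)).trans ?_
    simpa using leads_parsed w Γ'.cons l
  | cons a u ih =>
    simp only [List.mem_cons, not_or] at hu
    simp only [List.length_cons] at hlen
    refine (leads_branch (by rfl)).trans ((leads_parsed w a (u ++ Γ'.cons :: l)).trans ?_)
    rw [if_neg (Ne.symm hu.1), if_pos (by omega), List.append_cons w a u]
    exact ih hu.2 (by simp; omega)

theorem leads_afterParse (w : List Γ') (S : K' → List Γ') :
    Leads P.instr p ⟨P.afterParse w, S, pos, out⟩
      ⟨P.readFrom 0 default, S, pos, out ++ (P.decode w).toList⟩ := by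
  rw [afterParse]
  cases P.decode w with
  | none => simpa using Leads.refl _
  | some x =>
    have h : P.instr (emit (P.equiv x)) = .out x (P.readFrom 0 default) :=
      congrArg (Type2Instr.out · _) (P.equiv.symm_apply_apply x)
    exact leads_out h

/-- With the read heads of the tapes below `j` already advanced to cell `t + 1`, reading the other
tapes makes the loop evaluate the code for the symbols in cell `t`. -/
theorem leads_readFrom {t j n : ℕ} (hj : j + n = k) (r : Fin k → τ) (S : K' → List Γ') :
    Leads P.instr p ⟨P.readFrom j r, S, fun i => if i.1 < j then t + 1 else t, out⟩
      ⟨start (P.code fun i => if i.1 < j then P.equiv.symm (r i) else p i t), S,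
        fun _ => t + 1, out⟩ := by
  induction n generalizing j r with
  | zero =>
    have hlt : ∀ i : Fin k, i.1 < j := fun i => by omega
    simpa [readFrom, show ¬ j < k by omega, hlt] using Leads.refl _
  | succ n ih =>
    have hjk : j < k := by omega
    have hlt : ∀ i : Fin k, i ≠ ⟨j, hjk⟩ → (i.1 < j + 1 ↔ i.1 < j) := fun i hi => by
      have := Fin.val_ne_of_ne hi
      grind
    let pos : Fin k → ℕ := fun i => if i.1 < j then t + 1 else t
    let r' := Function.update r ⟨j, hjk⟩ (P.equiv (p ⟨j, hjk⟩ (pos ⟨j, hjk⟩)))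
    have hpos : Function.update pos ⟨j, hjk⟩ (pos ⟨j, hjk⟩ + 1) =
        fun i => if i.1 < j + 1 then t + 1 else t := by
      funext i
      by_cases hi : i = ⟨j, hjk⟩ <;> simp [hi, pos, hlt]
    have hr' : (fun i => if i.1 < j + 1 then P.equiv.symm (r' i) else p i t) =
        fun i => if i.1 < j then P.equiv.symm (r i) else p i t := by
      funext i
      by_cases hi : i = ⟨j, hjk⟩ <;> simp [hi, pos, r', hlt]
    have hread : Leads P.instr p ⟨.read ⟨j, hjk⟩ r, S, pos, out⟩
        ⟨P.readFrom (j + 1) r', S, Function.update pos ⟨j, hjk⟩ (pos ⟨j, hjk⟩ + 1), out⟩ :=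
      leads_read (by rfl) (by rfl)
    rw [readFrom, dif_pos hjk, ← hr']
    exact hread.trans (hpos ▸ ih (by omega) r')

theorem allowed_afterParse (hF : ∀ r, codeSupp (P.code r) Cont'.halt ⊆ F) (w : List Γ') :
    P.Allowed F (P.afterParse w) := by
  unfold afterParse
  split
  · trivial
  · exact allowed_readFrom hF _ _

theorem allowed_targets_run (hF : ∀ l ∈ F, TM2.SupportsStmt F (tr l)) {q : CodeStmt}
    (hq : ∃ l ∈ F, q ∈ TM2.stmts₁ (tr l)) (v : Option Γ') :
    ∀ y ∈ (P.instr (run q v)).targets, P.Allowed F y := by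
  have hsub {q' : CodeStmt} (h : q' ∈ TM2.stmts₁ q) : ∃ l ∈ F, q' ∈ TM2.stmts₁ (tr l) :=
    hq.imp fun l hl => ⟨hl.1, TM2.stmts₁_trans hl.2 h⟩
  cases q with
  | push κ f q =>
    rintro _ rfl
    exact hsub (by simp [TM2.stmts₁, TM2.stmts₁_self])
  | peek κ f q =>
    rintro _ ⟨x, rfl⟩
    exact hsub (q' := q) (by simp [TM2.stmts₁, TM2.stmts₁_self])
  | pop κ f q =>
    rintro _ ⟨x, rfl⟩
    cases x <;> exact hsub (q' := q) (by simp [TM2.stmts₁, TM2.stmts₁_self])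
  | load f q =>
    rintro _ ⟨x, rfl⟩
    exact hsub (q' := q) (by simp [TM2.stmts₁, TM2.stmts₁_self])
  | branch f q₁ q₂ =>
    rintro _ ⟨x, rfl⟩
    change P.Allowed F (cond (f v) (run q₁ v) (run q₂ v))
    cases f v
    · exact hsub (q' := q₂) (by simp [TM2.stmts₁, TM2.stmts₁_self])
    · exact hsub (q' := q₁) (by simp [TM2.stmts₁, TM2.stmts₁_self])
  | goto f =>
    rintro _ ⟨x, rfl⟩
    obtain ⟨l, hl, hq⟩ := hq
    exact ⟨f v, TM2.stmts₁_supportsStmt_mono hq (hF l hl) v, TM2.stmts₁_self⟩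
  | halt =>
    rintro _ ⟨x, rfl⟩
    exact Nat.zero_le _

theorem allowed_targets (hF : ∀ l ∈ F, TM2.SupportsStmt F (tr l))
    (hcode : ∀ r, codeSupp (P.code r) Cont'.halt ⊆ F) {x : LoopState k τ}
    (hx : P.Allowed F x) : ∀ y ∈ (P.instr x).targets, P.Allowed F y := by
  cases x with
  | run q v => exact allowed_targets_run hF hx v
  | push a κ q v => rintro _ rfl; exact hx
  | pop κ q v => rintro _ rfl; exact hx
  | parse w => rintro _ ⟨x, rfl⟩; cases x <;> exact hx
  | parsed w a =>
    rintro _ rfl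
    split_ifs with ha hlen
    · exact allowed_afterParse hcode w
    · simpa [Allowed] using hlen
    · exact hx
  | emit x => rintro _ rfl; exact allowed_readFrom hcode _ _
  | read j r => rintro _ ⟨x, rfl⟩; trivial
  | move j r => rintro _ rfl; exact allowed_readFrom hcode _ _

theorem instr_ne_halt (x : LoopState k τ) : P.instr x ≠ .halt := by
  cases x with
  | run q v => cases q <;> exact fun h => nomatch h
  | _ => exact fun h => nomatch h

theorem exists_type2Machine [Finite σ] (P : CodeLoop σ k τ) (c : ToPartrec.Code) :
    ∃ M : Type2Machine σ k, ∀ p q,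
      (∀ i, ∃ d, Leads P.instr p ⟨start c, mainStack [], fun _ => 0, []⟩ d ∧
        d.output[i]? = some (q i)) → M.YieldsSeq p q := by
  have : Finite τ := .of_equiv σ P.equiv
  obtain ⟨F, hc, hcode, hF⟩ := exists_supporting_labels P c
  refine ⟨restrictProgram P.instr none _ (P.finite_allowed F) ⟨start c, allowed_start P hc⟩,
    fun p q hq => restrictProgram_yieldsSeq (fun x hx y hy => allowed_targets hF hcode hx y hy)
      (fun x _ => P.instr_ne_halt x) fun i => ?_⟩
  obtain ⟨d, hd, hi⟩ := hq i
  obtain ⟨d', hreach, hd'⟩ := hd ⟨start c, fun _ => 0, fun _ _ => none, fun _ => 0, []⟩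
    ⟨rfl, fun κ i => by cases κ <;> simp, rfl, rfl⟩
  exact ⟨d', hreach, hd'.output ▸ hi⟩

end CodeLoop

theorem trPosNum_injective : Function.Injective trPosNum := by
  have hnil : ∀ a, trPosNum a ≠ [] := fun a => by cases a <;> exact List.cons_ne_nil _ _
  intro a
  induction a with
  | one => rintro (_ | b | b) h <;> simp_all [trPosNum, (hnil _).symm]
  | bit0 a ih | bit1 a ih =>
    rintro (_ | b | b) h
    all_goals first | simp [trPosNum, hnil] at h; done | exact congrArg _ (ih (List.cons.inj h).2)

theorem trNum_injective : Function.Injective trNum := by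
  have hnil : ∀ a, trPosNum a ≠ [] := fun a => by cases a <;> exact List.cons_ne_nil _ _
  rintro (_ | a) (_ | b) h
  · rfl
  · exact absurd h.symm (hnil b)
  · exact absurd h (hnil a)
  · exact congrArg Num.pos (trPosNum_injective h)

theorem trNat_injective : Function.Injective trNat :=
  trNum_injective.comp Nat.cast_injective

theorem cons_notMem_trNat (n : ℕ) : Γ'.cons ∉ trNat n := fun h => by
  simpa using trNat_natEnd n _ h

theorem exists_code_of_primrec {f : ℕ → ℕ} (hf : Primrec f) :
    ∃ c : ToPartrec.Code, ∀ n, c.eval [n] = pure [f n] := by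
  obtain ⟨c, hc⟩ := ToPartrec.Code.exists_code
    ((Nat.Partrec'.part_iff₁ (f := fun n => Part.some (f n))).2 hf.to_comp)
  exact ⟨c, fun n => (hc (n ::ᵥ List.Vector.nil)).trans (by simp)⟩

section Implements

open CodeLoop Encodable

variable {σ : Type s} {k : ℕ} {τ : Type} {S : Type*} [Primcodable σ] [Primcodable S]
  {step : (Fin k → σ) → S → Option σ × S}

/-- The loop `P` executes the rule `step`: in a round in which the tuple `r` of symbols is read, a
loop in state `s` writes the symbol `(step r s).1`, if any, and goes to the state `(step r s).2`. -/
structure CodeLoop.Implements (P : CodeLoop σ k τ) (step : (Fin k → σ) → S → Option σ × S) :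
    Prop where
  mem_eval : ∀ r s, [encode (step r s).1, encode (step r s).2] ∈ (P.code r).eval [encode s]
  decode_trNat : ∀ o : Option σ, P.decode (trNat (encode o)) = o
  length_trNat_le : ∀ o : Option σ, (trNat (encode o)).length ≤ P.maxLength

theorem exists_implements [Finite σ] (e : σ ≃ τ) (hstep : ∀ r, Primrec (step r)) :
    ∃ P : CodeLoop σ k τ, P.Implements step := by
  have hcode : ∀ r, ∃ c : ToPartrec.Code, ∀ s,
      [encode (step r s).1, encode (step r s).2] ∈ c.eval [encode s] := by
    intro r
    let run (n : ℕ) : Option (Option σ × S) := (decode n : Option S).map (step r)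
    have hrun : Primrec run := Primrec.option_map Primrec.decode ((hstep r).comp₂ .right)
    obtain ⟨c₁, h₁⟩ := exists_code_of_primrec
      (Primrec.encode.comp (Primrec.option_map hrun (Primrec.fst.comp₂ .right)))
    obtain ⟨c₂, h₂⟩ := exists_code_of_primrec
      (Primrec.encode.comp (Primrec.option_map hrun (Primrec.snd.comp₂ .right)))
    refine ⟨.comp (.cons .pred (.comp .pred .tail)) (.cons c₁ c₂), fun s => ?_⟩
    have hpred (n : ℕ) : (Part.some [n + 1] >>= ToPartrec.Code.pred.eval) = pure [n] :=
      (Part.bind_some _ _).trans (by simp)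
    simp [h₁, h₂, run, hpred]
  choose code hcode using hcode
  have hinj : Function.Injective fun o : Option σ => trNat (encode o) :=
    trNat_injective.comp encode_injective
  obtain ⟨B, hB⟩ := (Set.finite_range fun o : Option σ => (trNat (encode o)).length).bddAbove
  exact ⟨⟨e, code, Function.invFun fun o => trNat (encode o), B⟩, hcode,
    Function.leftInverse_invFun hinj, fun o => hB ⟨o, rfl⟩⟩

/-- The output symbol and the state of a loop with the rule `step` and initial state `s₀` after
`t` rounds, where `r t` is the tuple of symbols read in round `t`. -/
def loopTrace (step : (Fin k → σ) → S → Option σ × S) (s₀ : S) (r : ℕ → Fin k → σ) :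
    ℕ → Option σ × S
  | 0 => (none, s₀)
  | t + 1 => step (r t) (loopTrace step s₀ r t).2

/-- The word written by a loop before round `t`; the output symbol of a round is written at the
beginning of the next one. -/
def loopWritten (step : (Fin k → σ) → S → Option σ × S) (s₀ : S) (r : ℕ → Fin k → σ) :
    ℕ → List σ
  | 0 => []
  | t + 1 => loopWritten step s₀ r t ++ (loopTrace step s₀ r t).1.toList

variable [Inhabited τ] {P : CodeLoop σ k τ} {p : Fin k → ℕ → σ}

theorem CodeLoop.Implements.leads_round (hP : P.Implements step) (o : Option σ) (s : S) (t : ℕ)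
    (out : List σ) :
    Leads P.instr p ⟨.parse [], mainStack (trList [encode o, encode s]), fun _ => t, out⟩
      ⟨.parse [], mainStack (trList [encode (step (fun j => p j t) s).1,
        encode (step (fun j => p j t) s).2]), fun _ => t + 1, out ++ o.toList⟩ := by
  have hparse := leads_parse (P := P) (p := p) (pos := fun _ => t) (out := out) (w := [])
    (l := trList [encode s]) (cons_notMem_trNat (encode o)) (by simpa using hP.length_trNat_le o)
  have hemit := leads_afterParse (P := P) (p := p) (pos := fun _ => t) (out := out)
    (trNat (encode o)) (mainStack (trList [encode s]))
  rw [hP.decode_trNat] at hemit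
  have hread := leads_readFrom (P := P) (p := p) (t := t) (out := out ++ o.toList) (zero_add k)
    default (mainStack (trList [encode s]))
  simp only [Nat.not_lt_zero, if_false] at hread
  exact hparse.trans (hemit.trans (hread.trans (leads_eval (hP.mem_eval _ s))))

theorem CodeLoop.Implements.leads_loop (hP : P.Implements step) (s₀ : S) (t : ℕ) :
    Leads P.instr p
      ⟨.parse [], mainStack (trList [encode (none : Option σ), encode s₀]), fun _ => 0, []⟩
      ⟨.parse [], mainStack (trList [encode (loopTrace step s₀ (fun t j => p j t) t).1,
        encode (loopTrace step s₀ (fun t j => p j t) t).2]), fun _ => t,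
        loopWritten step s₀ (fun t j => p j t) t⟩ := by
  induction t with
  | zero => exact .refl _
  | succ t ih => exact ih.trans (hP.leads_round _ _ t _)

theorem exists_type2Machine_loop [Finite σ] [Nonempty σ] (s₀ : S)
    (hstep : ∀ r, Primrec (step r)) :
    ∃ M : Type2Machine σ k, ∀ p q,
      (∀ i, ∃ t, (loopWritten step s₀ (fun t j => p j t) t)[i]? = some (q i)) →
        M.YieldsSeq p q := by
  obtain ⟨n, ⟨e⟩⟩ := Finite.exists_equiv_fin σ
  have : Inhabited (Fin n) := ⟨e (Classical.arbitrary σ)⟩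
  obtain ⟨P, hP⟩ := exists_implements e hstep
  obtain ⟨c, hc⟩ := exists_code_of_primrec (Primrec.const (encode s₀) : Primrec fun _ : ℕ => _)
  let c₀ : ToPartrec.Code := .cons .zero (.comp c .zero')
  have hc₀ : [encode (none : Option σ), encode s₀] ∈ c₀.eval [] := by
    have hzero : (Part.some [0] >>= c.eval) = pure [encode s₀] := (Part.bind_some _ _).trans (hc 0)
    simp [c₀, hzero]
  obtain ⟨M, hM⟩ := P.exists_type2Machine c₀
  refine ⟨M, fun p q hq => hM p q fun i => ?_⟩
  obtain ⟨t, ht⟩ := hq i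
  exact ⟨_, (leads_eval hc₀).trans (hP.leads_loop s₀ t), ht⟩

end Implements

end CodeLoop

section Approximation

open Filter Topology

variable {σ : Type s} {n : ℕ}

/-- The word `w` is a prefix of the sequence `q`. -/
def SeqPrefix (w : List σ) (q : ℕ → σ) : Prop :=
  ∀ i a, w[i]? = some a → q i = a

/-- The function `h` approximates the multi-function `g` to sequences: on prefixes of `p` it yields
prefixes of every `q ∈ g p`, and these become arbitrarily long if the precision, which is the first
argument of `h`, and the prefixes increase. -/
def ApproximatesSeq (h : ℕ → (Fin n → List σ) → List σ)
    (g : MultiFun (Fin n → ℕ → σ) (ℕ → σ)) : Prop :=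
  ∀ p, ∀ q ∈ g p,
    (∀ t u, (∀ j, SeqPrefix (u j) (p j)) → SeqPrefix (h t u) q) ∧
    ∀ N, ∃ t₀, ∀ t ≥ t₀, ∀ u, (∀ j, SeqPrefix (u j) (p j) ∧ t₀ ≤ (u j).length) →
      N ≤ (h t u).length

/-- The function `h` approximates the multi-function `g` to words: on prefixes of `p` it yields no
word except `w ∈ g p`, and it yields `w` if the precision and the prefixes are sufficient. -/
def ApproximatesWord (h : ℕ → (Fin n → List σ) → Option (List σ))
    (g : MultiFun (Fin n → ℕ → σ) (List σ)) : Prop :=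
  ∀ p, ∀ w ∈ g p,
    (∀ t u, (∀ j, SeqPrefix (u j) (p j)) → ∀ w' ∈ h t u, w' = w) ∧
    ∃ t₀, ∀ t ≥ t₀, ∀ u, (∀ j, SeqPrefix (u j) (p j) ∧ t₀ ≤ (u j).length) → h t u = some w

theorem seqPrefix_map_range_iff {q q' : ℕ → σ} {N : ℕ} :
    SeqPrefix ((List.range N).map q) q' ↔ ∀ i < N, q' i = q i := by
  constructor
  · exact fun h i hi => h i _ (by simp [hi])
  · intro h i a ha
    obtain ⟨hi, rfl⟩ := List.getElem?_eq_some_iff.1 ha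
    simpa using h i (by simpa using hi)

theorem seqPrefix_map_range (q : ℕ → σ) (N : ℕ) : SeqPrefix ((List.range N).map q) q :=
  seqPrefix_map_range_iff.2 fun _ _ => rfl

theorem SeqPrefix.map_range {w : List σ} {q q' : ℕ → σ} (h : SeqPrefix w q)
    (h' : SeqPrefix w q') {N : ℕ} (hN : N ≤ w.length) : SeqPrefix ((List.range N).map q) q' :=
  seqPrefix_map_range_iff.2 fun i hi =>
    have hw := List.getElem?_eq_getElem (hi.trans_le hN)
    (h' i _ hw).trans (h i _ hw).symm

theorem hasBasis_nhds_seq [TopologicalSpace σ] [DiscreteTopology σ] (q : ℕ → σ) :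
    (𝓝 q).HasBasis (fun _ => True) fun N => {q' | SeqPrefix ((List.range N).map q) q'} := by
  refine ⟨fun U => ?_⟩
  have hcyl (N : ℕ) : {q' | SeqPrefix ((List.range N).map q) q'} = PiNat.cylinder q N := by
    ext q'
    exact seqPrefix_map_range_iff
  simp only [hcyl, true_and]
  rw [(PiNat.isTopologicalBasis_cylinders fun _ => σ).mem_nhds_iff]
  constructor
  · rintro ⟨_, ⟨q', N, rfl⟩, hq, hU⟩
    exact ⟨N, (PiNat.mem_cylinder_iff_eq.1 hq).symm ▸ hU⟩
  · rintro ⟨N, hU⟩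
    exact ⟨_, ⟨q, N, rfl⟩, PiNat.self_mem_cylinder q N, hU⟩

theorem hasBasis_nhds_tuple [TopologicalSpace σ] [DiscreteTopology σ] (p : Fin n → ℕ → σ) :
    (𝓝 p).HasBasis (fun _ => True)
      fun M => {p' | ∀ j, SeqPrefix ((List.range M).map (p j)) (p' j)} := by
  rw [nhds_pi]
  refine (hasBasis_pi fun j => hasBasis_nhds_seq (p j)).to_hasBasis ?_ ?_
  · rintro ⟨I, N⟩ -
    refine ⟨Finset.univ.sup N, trivial, fun p' hp' j _ => seqPrefix_map_range_iff.2 fun i hi => ?_⟩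
    exact seqPrefix_map_range_iff.1 (hp' j) i (hi.trans_le (Finset.le_sup (Finset.mem_univ j)))
  · exact fun M _ => ⟨(Set.univ, fun _ => M), ⟨Set.finite_univ, fun _ _ => trivial⟩,
      fun p' hp' j => hp' j trivial⟩

theorem continuous_asSubtype_iff [TopologicalSpace σ] [DiscreteTopology σ] {B : Type*}
    [TopologicalSpace B] {ι : Type*} {V : B → ι → Set B}
    (hV : ∀ b, (𝓝 b).HasBasis (fun _ => True) (V b)) {g : (Fin n → ℕ → σ) →. B} :
    Continuous g.asSubtype ↔ ∀ p, ∀ b ∈ g p, ∀ i, ∃ M, ∀ p', ∀ b' ∈ g p',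
      (∀ j, SeqPrefix ((List.range M).map (p j)) (p' j)) → b' ∈ V b i := by
  have hbasis (p : g.Dom) := (hasBasis_nhds_tuple p.1).comap (Subtype.val : g.Dom → _)
  have hcont : Continuous g.asSubtype ↔ ∀ p : g.Dom, ∀ i, ∃ M, ∀ p' : g.Dom,
      (∀ j, SeqPrefix ((List.range M).map (p.1 j)) (p'.1 j)) →
        g.asSubtype p' ∈ V (g.asSubtype p) i := by
    refine continuous_iff_continuousAt.trans (forall_congr' fun p => ?_)
    rw [ContinuousAt, nhds_subtype_eq_comap, (hbasis p).tendsto_iff (hV _)]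
    simp
  rw [hcont]
  constructor
  · rintro h p _ ⟨hp, rfl⟩ i
    refine (h ⟨p, hp⟩ i).imp fun M hM => ?_
    rintro p' _ ⟨hp', rfl⟩
    exact hM ⟨p', hp'⟩
  · exact fun h p i => (h p _ ⟨p.2, rfl⟩ i).imp fun M hM p' => hM p' _ ⟨p'.2, rfl⟩

theorem continuousToSeq_iff {g : (Fin n → ℕ → σ) →. (ℕ → σ)} :
    ContinuousToSeq g ↔ ∀ p, ∀ q ∈ g p, ∀ N, ∃ M, ∀ p', ∀ q' ∈ g p',
      (∀ j, SeqPrefix ((List.range M).map (p j)) (p' j)) →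
        SeqPrefix ((List.range N).map q) q' := by
  let _ : TopologicalSpace σ := ⊥
  have : DiscreteTopology σ := ⟨rfl⟩
  exact continuous_asSubtype_iff hasBasis_nhds_seq

theorem continuousToWord_iff {g : (Fin n → ℕ → σ) →. List σ} :
    ContinuousToWord g ↔ ∀ p, ∀ w ∈ g p, ∃ M, ∀ p', ∀ w' ∈ g p',
      (∀ j, SeqPrefix ((List.range M).map (p j)) (p' j)) → w' = w := by
  let _ : TopologicalSpace σ := ⊥
  let _ : TopologicalSpace (List σ) := ⊥
  have : DiscreteTopology σ := ⟨rfl⟩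
  have : DiscreteTopology (List σ) := ⟨rfl⟩
  have hV (w : List σ) : (𝓝 w).HasBasis (fun _ : Unit => True) fun _ => {w} :=
    nhds_discrete (List σ) ▸ hasBasis_pure w
  exact (continuous_asSubtype_iff hV).trans (by simp)

/-- On words `u`, a longest of the words up to the precision that are prefixes of all values of `g`
on extensions of `u` approximates `g`. -/
theorem ContinuousToSeq.exists_approximates {g : (Fin n → ℕ → σ) →. (ℕ → σ)}
    (hg : ContinuousToSeq g) : ∃ h, ApproximatesSeq h g.toMultiFun := by
  classical
  let Forced (u : Fin n → List σ) (w : List σ) : Prop :=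
    ∀ p, (∀ j, SeqPrefix (u j) (p j)) → ∀ q ∈ g p, SeqPrefix w q
  have hex (t : ℕ) (u : Fin n → List σ) :
      ∃ w, Forced u w ∧ ∀ w', Forced u w' → w'.length ≤ t → w'.length ≤ w.length := by
    let Len (m : ℕ) : Prop := ∃ w, Forced u w ∧ w.length = m
    obtain ⟨w, hw, hlen⟩ : Len (Nat.findGreatest Len t) :=
      Nat.findGreatest_spec t.zero_le ⟨[], fun _ _ _ _ _ _ h => by simp at h, rfl⟩
    exact ⟨w, hw, fun w' hw' ht => hlen ▸ Nat.le_findGreatest ht ⟨w', hw', rfl⟩⟩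
  choose h hforced hmax using hex
  refine ⟨h, fun p q hq => ⟨fun t u hu => hforced t u p hu q hq, fun N => ?_⟩⟩
  obtain ⟨M, hM⟩ := continuousToSeq_iff.1 hg p q hq N
  refine ⟨max M N, fun t ht u hu => ?_⟩
  have hq : Forced u ((List.range N).map q) := fun p' hp' q' hq' => hM p' q' hq' fun j =>
    (hu j).1.map_range (hp' j) ((le_max_left M N).trans (hu j).2)
  simpa using hmax t u _ hq (by simpa using (le_max_right M N).trans ht)

theorem ContinuousToWord.exists_approximates {g : (Fin n → ℕ → σ) →. List σ}
    (hg : ContinuousToWord g) : ∃ h, ApproximatesWord h g.toMultiFun := by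
  let Forced (u : Fin n → List σ) (w : List σ) : Prop :=
    ∀ p, (∀ j, SeqPrefix (u j) (p j)) → ∀ w' ∈ g p, w = w'
  have hex (u : Fin n → List σ) :
      ∃ o : Option (List σ), (∀ w ∈ o, Forced u w) ∧ ((∃ w, Forced u w) → o.isSome) := by
    by_cases hu : ∃ w, Forced u w
    · obtain ⟨w, hw⟩ := hu
      exact ⟨some w, by simpa using hw, fun _ => rfl⟩
    · exact ⟨none, by simp, fun h => (hu h).elim⟩
  choose h hforced hsome using hex
  refine ⟨fun _ => h, fun p w hw => ⟨fun _ u hu w' hw' => hforced u w' hw' p hu w hw, ?_⟩⟩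
  obtain ⟨M, hM⟩ := continuousToWord_iff.1 hg p w hw
  refine ⟨M, fun _ _ u hu => ?_⟩
  have hw' : Forced u w := fun p' hp' w' hw' =>
    (hM p' w' hw' fun j => (hu j).1.map_range (hp' j) (hu j).2).symm
  obtain ⟨w', hw'⟩ := Option.isSome_iff_exists.1 (hsome u ⟨w, hw'⟩)
  exact hw'.trans (congrArg some (hforced u w' hw' p (fun j => (hu j).1) w hw))

theorem ApproximatesSeq.continuousToSeq {g : (Fin n → ℕ → σ) →. (ℕ → σ)}
    {h : ℕ → (Fin n → List σ) → List σ} (hg : ApproximatesSeq h g.toMultiFun) :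
    ContinuousToSeq g := by
  refine continuousToSeq_iff.2 fun p q hq N => ?_
  obtain ⟨hsound, hcomplete⟩ := hg p q hq
  obtain ⟨t₀, ht₀⟩ := hcomplete N
  let u : Fin n → List σ := fun j => (List.range t₀).map (p j)
  have hu : ∀ j, SeqPrefix (u j) (p j) := fun j => seqPrefix_map_range _ _
  exact ⟨t₀, fun p' q' hq' hp' => (hsound t₀ u hu).map_range ((hg p' q' hq').1 t₀ u hp')
    (ht₀ t₀ le_rfl u fun j => ⟨hu j, by simp [u]⟩)⟩

end Approximation

section OfApproximation

variable {σ : Type s} {k : ℕ}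

/-- The word written within `t` rounds if in round `t` the word `a t` is known and its first symbol
that has not been written yet, if there is one, is appended. -/
def emitted (a : ℕ → List σ) : ℕ → List σ
  | 0 => []
  | t + 1 => emitted a t ++ ((a t)[(emitted a t).length]?).toList

theorem seqPrefix_emitted {a : ℕ → List σ} {q : ℕ → σ} (ha : ∀ t, SeqPrefix (a t) q) (t : ℕ) :
    SeqPrefix (emitted a t) q := by
  induction t with
  | zero => exact fun i x h => by simp [emitted] at h
  | succ t ih =>
    intro i x h
    rw [emitted, List.getElem?_append] at h
    split_ifs at h with hi
    · exact ih i x h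
    · cases hx : (a t)[(emitted a t).length]? with
      | none => simp [hx] at h
      | some y =>
        rw [hx, Option.toList_some, List.getElem?_singleton] at h
        split_ifs at h with hi'
        cases h
        exact ha t i x (by rwa [show i = (emitted a t).length by omega])

theorem monotone_length_emitted (a : ℕ → List σ) : Monotone fun t => (emitted a t).length :=
  monotone_nat_of_le_succ fun t => by simp [emitted]

theorem exists_le_length_emitted {a : ℕ → List σ} (ha : ∀ N, ∃ t₀, ∀ t ≥ t₀, N ≤ (a t).length)
    (N : ℕ) : ∃ t, N ≤ (emitted a t).length := by
  induction N with
  | zero => exact ⟨0, Nat.zero_le _⟩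
  | succ N ih =>
    obtain ⟨t₁, ht₁⟩ := ih
    obtain ⟨t₀, ht₀⟩ := ha (N + 1)
    have hN : N ≤ (emitted a (max t₀ t₁)).length :=
      ht₁.trans (monotone_length_emitted a (le_max_right t₀ t₁))
    refine ⟨max t₀ t₁ + 1, ?_⟩
    rcases hN.eq_or_lt with hN | hN
    · have hlen : N < (a (max t₀ t₁)).length := ht₀ _ (le_max_left t₀ t₁)
      simp [emitted, ← hN, hlen]
    · exact hN.trans_le (monotone_length_emitted a (Nat.le_succ _))

theorem exists_getElem?_emitted {a : ℕ → List σ} {q : ℕ → σ} (hq : ∀ t, SeqPrefix (a t) q)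
    (ha : ∀ N, ∃ t₀, ∀ t ≥ t₀, N ≤ (a t).length) (i : ℕ) :
    ∃ t, (emitted a t)[i]? = some (q i) := by
  obtain ⟨t, ht⟩ := exists_le_length_emitted ha (i + 1)
  have hi := List.getElem?_eq_getElem (l := emitted a t) ht
  exact ⟨t, hi.trans (congrArg some (seqPrefix_emitted hq t i _ hi).symm)⟩

/-- The words `u`, extended by one symbol each. -/
def extendWords (r : Fin k → σ) (u : Fin k → List σ) : Fin k → List σ :=
  fun j => u j ++ [r j]

/-- The rule of a loop that writes the limit of the approximation `h`. The state consists of the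
precision, the number of symbols already written, and the symbols already read. -/
def limitStep (h : ℕ → (Fin k → List σ) → List σ) (r : Fin k → σ)
    (s : ℕ × ℕ × (Fin k → List σ)) : Option σ × ℕ × ℕ × (Fin k → List σ) :=
  let o := (h (s.1 + 1) (extendWords r s.2.2))[s.2.1]?
  (o, s.1 + 1, s.2.1 + o.toList.length, extendWords r s.2.2)

theorem primrec_extendWords [Primcodable σ] (r : Fin k → σ) : Primrec (extendWords r) :=
  Primrec.fin_curry.2 <| Primrec.list_append.comp (Primrec.fin_app.comp .fst .snd)
    ((Primrec.dom_finite fun j => [r j]).comp .snd)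

theorem primrec_limitStep [Primcodable σ] {h : ℕ → (Fin k → List σ) → List σ} (hh : Primrec₂ h)
    (r : Fin k → σ) : Primrec (limitStep h r) := by
  have hwords : Primrec fun s : ℕ × ℕ × (Fin k → List σ) => extendWords r s.2.2 :=
    (primrec_extendWords r).comp (Primrec.snd.comp .snd)
  have htime : Primrec fun s : ℕ × ℕ × (Fin k → List σ) => s.1 + 1 := Primrec.succ.comp .fst
  have hout : Primrec fun s : ℕ × ℕ × (Fin k → List σ) =>
      (h (s.1 + 1) (extendWords r s.2.2))[s.2.1]? :=
    Primrec.list_getElem?.comp (hh.comp htime hwords) (Primrec.fst.comp .snd)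
  exact hout.pair <| htime.pair <| Primrec.pair (Primrec.nat_add.comp (Primrec.fst.comp .snd)
    (Primrec.list_length.comp (Primrec.optionToList.comp hout))) hwords

theorem loopTrace_limitStep (h : ℕ → (Fin k → List σ) → List σ) (p : Fin k → ℕ → σ) (t : ℕ) :
    let a := fun t => h (t + 1) fun j => (List.range (t + 1)).map (p j)
    let s₀ := (0, 0, fun _ => [])
    (loopTrace (limitStep h) s₀ (fun t j => p j t) t).2 =
        (t, (emitted a t).length, fun j => (List.range t).map (p j)) ∧
      loopWritten (limitStep h) s₀ (fun t j => p j t) (t + 1) = emitted a t := by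
  intro a s₀
  induction t with
  | zero => exact ⟨rfl, rfl⟩
  | succ t ih =>
    have hwords : extendWords (fun j => p j t) (fun j => (List.range t).map (p j)) =
        fun j => (List.range (t + 1)).map (p j) := by
      funext j
      simp [extendWords, List.range_succ]
    have htrace : loopTrace (limitStep h) s₀ (fun t j => p j t) (t + 1) =
        ((a t)[(emitted a t).length]?, t + 1, (emitted a (t + 1)).length,
          fun j => (List.range (t + 1)).map (p j)) := by
      rw [loopTrace, ih.1, limitStep, hwords, emitted, List.length_append]
    exact ⟨congrArg Prod.snd htrace, by rw [loopWritten, ih.2, htrace, emitted]⟩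

theorem ApproximatesSeq.computableToSeq [Primcodable σ] [Finite σ] [Nonempty σ]
    {g : (Fin k → ℕ → σ) →. (ℕ → σ)} {h : ℕ → (Fin k → List σ) → List σ} (hh : Primrec₂ h)
    (hg : ApproximatesSeq h g.toMultiFun) : ComputableToSeq g := by
  obtain ⟨M, hM⟩ := exists_type2Machine_loop (0, 0, fun _ => []) (primrec_limitStep hh)
  refine ⟨M, fun p q hq => hM p q fun i => ?_⟩
  obtain ⟨hsound, hcomplete⟩ := hg p q hq
  let a (t : ℕ) : List σ := h (t + 1) fun j => (List.range (t + 1)).map (p j)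
  have hpre (t : ℕ) : SeqPrefix (a t) q := hsound _ _ fun j => seqPrefix_map_range (p j) _
  have hlength (N : ℕ) : ∃ t₀, ∀ t ≥ t₀, N ≤ (a t).length :=
    (hcomplete N).imp fun t₀ ht₀ t ht => ht₀ _ (Nat.le_succ_of_le ht) _ fun j =>
      ⟨seqPrefix_map_range (p j) _, by simpa using Nat.le_succ_of_le ht⟩
  obtain ⟨t, ht⟩ := exists_getElem?_emitted hpre hlength i
  exact ⟨t + 1, (loopTrace_limitStep h p t).2 ▸ ht⟩

end OfApproximation

/-! ### Primitive recursive simulation of tapes -/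

/-- Some coding of a finite type. -/
@[reducible] noncomputable def primcodableOfFinite (α : Type*) [Finite α] : Primcodable α :=
  Primcodable.ofEquiv (Fin (Nat.card α)) (Finite.equivFin α)

section Tapes

theorem primrec₂_of_finite {ι α β : Type*} [Finite ι] [Primcodable ι] [Primcodable α]
    [Primcodable β] {f : ι → α → β} (hf : ∀ i, Primrec (f i)) : Primrec₂ f := by
  let e := Finite.equivFin ι
  have h : Primrec₂ fun (m : Fin (Nat.card ι)) a => f (e.symm m) a :=
    Primrec.fin_curry₁.2 fun m => hf _
  exact (h.comp ((Primrec.dom_finite e).comp .fst) .snd).of_eq fun x => by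
    rw [e.symm_apply_apply]

theorem primrec_apply {m : ℕ} {α : Type*} [Primcodable α] (i : Fin m) :
    Primrec fun f : Fin m → α => f i :=
  Primrec.fin_app.comp .id (.const i)

theorem primrec_update {m : ℕ} {α : Type*} [Primcodable α] (i : Fin m) :
    Primrec₂ fun (f : Fin m → α) (a : α) => Function.update f i a :=
  Primrec.fin_curry.2 <|
    (Primrec.ite (Primrec.eq.comp .snd (.const i)) (Primrec.snd.comp .fst)
      (Primrec.fin_app.comp (Primrec.fst.comp .fst) .snd)).of_eq fun ⟨⟨f, a⟩, j⟩ =>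
        (Function.update_apply f i a j).symm

theorem int_encode_ofNat (n : ℕ) : Encodable.encode (n : ℤ) = 2 * n := rfl

theorem int_encode_negSucc (n : ℕ) : Encodable.encode (Int.negSucc n) = 2 * n + 1 := rfl

theorem primrec_int_add_one : Primrec fun z : ℤ => z + 1 := by
  let f (n : ℕ) := if n % 2 = 0 then n + 2 else n - 2
  have hf : Primrec f := Primrec.ite
    (Primrec.eq.comp (Primrec.nat_mod.comp .id (.const 2)) (.const 0))
    (Primrec.nat_add.comp .id (.const 2)) (Primrec.nat_sub.comp .id (.const 2))
  refine Primrec.encode_iff.1 ((hf.comp .encode).of_eq ?_)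
  rintro (n | _ | n)
  · change f (2 * n) = 2 * (n + 1)
    grind
  · rfl
  · rw [show Int.negSucc (n + 1) + 1 = Int.negSucc n by lia, int_encode_negSucc,
      int_encode_negSucc]
    grind

theorem primrec_int_sub_one : Primrec fun z : ℤ => z - 1 := by
  let f (n : ℕ) := if n % 2 = 0 then if n = 0 then 1 else n - 2 else n + 2
  have hf : Primrec f := Primrec.ite
    (Primrec.eq.comp (Primrec.nat_mod.comp .id (.const 2)) (.const 0))
    (Primrec.ite (Primrec.eq.comp .id (.const 0)) (.const 1)
      (Primrec.nat_sub.comp .id (.const 2)))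
    (Primrec.nat_add.comp .id (.const 2))
  refine Primrec.encode_iff.1 ((hf.comp .encode).of_eq ?_)
  rintro ((_ | n) | n)
  · rfl
  · rw [show Int.ofNat (n + 1) - 1 = (n : ℤ) by lia, Int.ofNat_eq_natCast, int_encode_ofNat,
      int_encode_ofNat]
    grind
  · rw [show Int.negSucc n - 1 = Int.negSucc (n + 1) by lia, int_encode_negSucc,
      int_encode_negSucc]
    grind

/-- The inscriptions of `m` tapes, given by the list of all write operations, the latest first. -/
abbrev TapeLog (m : ℕ) (C : Type*) := List ((Fin m × ℤ) × C)

namespace TapeLog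

variable {m : ℕ} {C : Type*}

/-- The content of a cell of tapes that were initially blank. -/
def get (blank : C) (l : TapeLog m C) (i : Fin m) (z : ℤ) : C :=
  l.foldr (fun x c => if x.1 = (i, z) then x.2 else c) blank

theorem get_cons (blank : C) (l : TapeLog m C) (i : Fin m) (z : ℤ) (c : C) :
    get blank (((i, z), c) :: l) =
      Function.update (get blank l) i (Function.update (get blank l i) z c) := by
  funext i' z'
  by_cases hi : i' = i
  · subst hi
    by_cases hz : z' = z <;> simp [get, hz, Ne.symm]
  · simp [get, hi, Ne.symm hi]

theorem get_induction {blank : C} {l : TapeLog m C} {i : Fin m} {z : ℤ} {R : C → Prop}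
    (hl : ∀ x ∈ l, x.1 = (i, z) → R x.2) (hblank : (∀ x ∈ l, x.1 ≠ (i, z)) → R blank) :
    R (get blank l i z) := by
  induction l with
  | nil => exact hblank (by simp)
  | cons x l ih =>
    rw [get, List.foldr_cons]
    split_ifs with hx
    · exact hl x List.mem_cons_self hx
    · exact ih (fun y hy => hl y (List.mem_cons_of_mem _ hy)) fun h =>
        hblank (List.forall_mem_cons.2 ⟨hx, h⟩)

theorem primrec_get [Primcodable C] (blank : C) (i : Fin m) :
    Primrec₂ fun (l : TapeLog m C) z => get blank l i z := by
  refine Primrec.list_foldr (α := TapeLog m C × ℤ)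
    (h := fun a x => if x.1.1 = (i, a.2) then x.1.2 else x.2) .fst (.const blank) ?_
  exact Primrec.ite (Primrec.eq.comp (Primrec.fst.comp (Primrec.fst.comp .snd))
    (Primrec.pair (.const i) (Primrec.snd.comp .fst)))
    (Primrec.snd.comp (Primrec.fst.comp .snd)) (Primrec.snd.comp .snd)

end TapeLog

end Tapes

/-! ### Simulation of Type-2 machines on words -/

section WordData

theorem getElem?_eq_some_of_isPrefix {α : Type*} {w w' : List α} (h : w <+: w') {i : ℕ} {a : α}
    (ha : w[i]? = some a) : w'[i]? = some a := by
  obtain ⟨hi, rfl⟩ := List.getElem?_eq_some_iff.1 ha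
  exact List.prefix_iff_getElem?.1 h i hi

variable {σ : Type s} {k m : ℕ} {Γ Q : Type}

/-- The data of a configuration of a Type-2 machine apart from the state. It is a nested pair, so
that it inherits the coding of pairs. -/
abbrev WordData (σ : Type s) (k m : ℕ) (Γ : Type) :=
  (Fin k → ℕ) × TapeLog m Γ × (Fin m → ℤ) × List σ

namespace WordData

/-- The positions of the heads of the input tapes. -/
abbrev inPos (d : WordData σ k m Γ) : Fin k → ℕ := d.1

/-- The inscriptions of the work tapes. -/
abbrev log (d : WordData σ k m Γ) : TapeLog m Γ := d.2.1

/-- The positions of the heads of the work tapes. -/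
abbrev head (d : WordData σ k m Γ) : Fin m → ℤ := d.2.2.1

/-- The word written so far. -/
abbrev output (d : WordData σ k m Γ) : List σ := d.2.2.2

end WordData

/-- Execute an instruction in state `q` on the input words `u`; nothing happens if it
reads beyond the end of an input word. -/
def wordExec (blank : Γ) (q : Q) (u : Fin k → List σ) (d : WordData σ k m Γ) :
    Type2Instr σ k m Γ Q → Q × WordData σ k m Γ
  | .halt => (q, d)
  | .inBranch j next => (((u j)[d.inPos j]?.map next).getD q, d)
  | .inRight j next => (next, Function.update d.inPos j (d.inPos j + 1), d.2)
  | .branch i next => (next (d.log.get blank i (d.head i)), d)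
  | .right i next => (next, d.inPos, d.log, Function.update d.head i (d.head i + 1), d.output)
  | .left i next => (next, d.inPos, d.log, Function.update d.head i (d.head i - 1), d.output)
  | .write i a next => (next, d.inPos, ((i, d.head i), a) :: d.log, d.head, d.output)
  | .out a next => (next, d.inPos, d.log, d.head, d.output ++ [a])

theorem primrec_wordExec [Primcodable σ] [Primcodable Γ] [Primcodable Q] [Finite σ] [Finite Γ]
    (blank : Γ) (q : Q) (I : Type2Instr σ k m Γ Q) :
    Primrec fun x : (Fin k → List σ) × WordData σ k m Γ => wordExec blank q x.1 x.2 I := by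
  have hpos : Primrec fun x : (Fin k → List σ) × WordData σ k m Γ => x.2.inPos :=
    Primrec.fst.comp .snd
  have hlog : Primrec fun x : (Fin k → List σ) × WordData σ k m Γ => x.2.log :=
    Primrec.fst.comp (Primrec.snd.comp .snd)
  have hhead : Primrec fun x : (Fin k → List σ) × WordData σ k m Γ => x.2.head :=
    Primrec.fst.comp (Primrec.snd.comp (Primrec.snd.comp .snd))
  have hout : Primrec fun x : (Fin k → List σ) × WordData σ k m Γ => x.2.output :=
    Primrec.snd.comp (Primrec.snd.comp (Primrec.snd.comp .snd))
  have hheadAt (i : Fin m) := (primrec_apply i).comp hhead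
  cases I with
  | halt => exact .pair (.const q) .snd
  | inBranch j next =>
    have hsymbol := Primrec.list_getElem?.comp ((primrec_apply j).comp .fst)
      ((primrec_apply j).comp hpos)
    exact .pair (Primrec.option_getD.comp
      (Primrec.option_map hsymbol ((Primrec.dom_finite next).comp₂ .right)) (.const q)) .snd
  | inRight j next =>
    exact .pair (.const next) (.pair ((primrec_update j).comp hpos
      (Primrec.succ.comp ((primrec_apply j).comp hpos))) (.comp .snd .snd))
  | branch i next =>
    exact .pair ((Primrec.dom_finite next).comp
      ((TapeLog.primrec_get blank i).comp hlog (hheadAt i))) .snd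
  | right i next =>
    exact .pair (.const next) (.pair hpos (.pair hlog (.pair
      ((primrec_update i).comp hhead (primrec_int_add_one.comp (hheadAt i))) hout)))
  | left i next =>
    exact .pair (.const next) (.pair hpos (.pair hlog (.pair
      ((primrec_update i).comp hhead (primrec_int_sub_one.comp (hheadAt i))) hout)))
  | write i a next =>
    exact .pair (.const next) (.pair hpos (.pair
      (Primrec.list_cons.comp (.pair (.pair (.const i) (hheadAt i)) (.const a)) hlog)
      (.pair hhead hout)))
  | out a next =>
    exact .pair (.const next) (.pair hpos (.pair hlog
      (.pair hhead (Primrec.list_append.comp hout (.const [a])))))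

end WordData

section WordSimulation

variable {σ : Type s} {k : ℕ}

/-- The configurations of the simulation of a Type-2 machine on words. -/
abbrev WordConfig (M : Type2Machine σ k) := M.Q × WordData σ k M.m M.Γ

/-- One step of the simulation on input words `u`. -/
def wordStep (M : Type2Machine σ k) (u : Fin k → List σ) (c : WordConfig M) : WordConfig M :=
  wordExec M.blank c.1 u c.2 (M.instr c.1)

/-- The configuration after `t` steps of the simulation on input words `u`. -/
def wordRun (M : Type2Machine σ k) (t : ℕ) (u : Fin k → List σ) : WordConfig M :=
  (wordStep M u)^[t] (M.start, fun _ => 0, [], fun _ => 0, [])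

/-- The output of the simulation on input words `u` if it halts within `t` steps. -/
noncomputable def wordHaltOutput (M : Type2Machine σ k) (t : ℕ) (u : Fin k → List σ) :
    Option (List σ) :=
  open Classical in
  if M.instr (wordRun M t u).1 = .halt then some (wordRun M t u).2.output else none

/-- The configuration of the machine that is described by a configuration of the simulation. -/
def WordConfig.toConfig {M : Type2Machine σ k} (c : WordConfig M) : M.Config :=
  ⟨c.1, c.2.inPos, c.2.log.get M.blank, c.2.head, c.2.output⟩

section Primrec

variable (M : Type2Machine σ k) [Primcodable σ] [Finite σ]

theorem primrec_wordRun [Primcodable M.Q] [Primcodable M.Γ] : Primrec₂ (wordRun M) := by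
  have := M.finite_Q
  have := M.finite_Γ
  have hexec : Primrec₂ fun (q : M.Q) (x : (Fin k → List σ) × WordData σ k M.m M.Γ) =>
      wordExec M.blank q x.1 x.2 (M.instr q) :=
    primrec₂_of_finite fun q => primrec_wordExec M.blank q (M.instr q)
  refine Primrec.nat_iterate .fst (.const _) ?_
  exact hexec.comp (Primrec.fst.comp .snd)
    (Primrec.pair (Primrec.snd.comp .fst) (Primrec.snd.comp .snd))

theorem primrec_output_wordRun : Primrec₂ fun t u => (wordRun M t u).2.output := by
  have := M.finite_Q
  have := M.finite_Γ
  let _ := primcodableOfFinite M.Q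
  let _ := primcodableOfFinite M.Γ
  exact (Primrec.snd.comp (Primrec.snd.comp (Primrec.snd.comp .snd))).comp₂ (primrec_wordRun M)

theorem primrec_wordHaltOutput : Primrec₂ (wordHaltOutput M) := by
  classical
  have := M.finite_Q
  have := M.finite_Γ
  let _ := primcodableOfFinite M.Q
  let _ := primcodableOfFinite M.Γ
  have hhalt : PrimrecPred fun q => M.instr q = .halt := ⟨inferInstance, .dom_finite _⟩
  exact Primrec.ite (hhalt.comp (Primrec.fst.comp (primrec_wordRun M)))
    (Primrec.option_some.comp (primrec_output_wordRun M)) (.const none)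

end Primrec

variable {M : Type2Machine σ k} {p : Fin k → ℕ → σ} {u : Fin k → List σ}

theorem wordStep_of_halt {c : WordConfig M} (hc : M.instr c.1 = .halt) : wordStep M u c = c := by
  rw [wordStep, hc]
  rfl

theorem step_toConfig_or_wordStep_eq (hu : ∀ j, SeqPrefix (u j) (p j)) (c : WordConfig M) :
    M.step p c.toConfig = some (wordStep M u c).toConfig ∨
      wordStep M u c = c ∧ (M.step p c.toConfig = none ∨ ∃ j, (u j).length ≤ c.2.inPos j) := by
  obtain ⟨q, pos, log, head, out⟩ := c
  simp only [wordStep, Type2Machine.step, WordConfig.toConfig]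
  cases hI : M.instr q with
  | halt => exact .inr ⟨rfl, .inl rfl⟩
  | inBranch j next =>
    simp only [wordExec]
    cases hx : (u j)[pos j]? with
    | none => exact .inr ⟨rfl, .inr ⟨j, List.getElem?_eq_none_iff.1 hx⟩⟩
    | some x => exact .inl (by rw [hu j _ _ hx]; rfl)
  | write i a next =>
    refine .inl ?_
    simp only [wordExec, WordData.inPos, WordData.log, WordData.head, WordData.output,
      TapeLog.get_cons]
  | _ => exact .inl rfl

theorem inPos_wordStep_le (c : WordConfig M) (j : Fin k) :
    (wordStep M u c).2.inPos j ≤ c.2.inPos j + 1 := by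
  obtain ⟨q, pos, log, head, out⟩ := c
  simp only [wordStep]
  cases hI : M.instr q with
  | inRight j' next =>
    by_cases h : j = j'
    · subst h
      simp [wordExec, WordData.inPos]
    · simp [wordExec, WordData.inPos, Function.update_of_ne h]
  | _ => exact Nat.le_succ _

theorem length_output_le_wordStep (c : WordConfig M) :
    c.2.output.length ≤ (wordStep M u c).2.output.length := by
  obtain ⟨q, pos, log, head, out⟩ := c
  simp only [wordStep]
  cases hI : M.instr q with
  | out a next => simp [wordExec, WordData.output]
  | _ => exact le_rfl

theorem wordRun_succ (t : ℕ) : wordRun M (t + 1) u = wordStep M u (wordRun M t u) :=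
  Function.iterate_succ_apply' _ _ _

theorem wordRun_eq_of_halt {t t' : ℕ} (htt' : t ≤ t') (ht : M.instr (wordRun M t u).1 = .halt) :
    wordRun M t' u = wordRun M t u := by
  induction t', htt' using Nat.le_induction with
  | base => rfl
  | succ t' _ ih => rw [wordRun_succ, ih, wordStep_of_halt ht]

theorem monotone_length_output_wordRun : Monotone fun t => (wordRun M t u).2.output.length :=
  monotone_nat_of_le_succ fun t => by
    rw [wordRun_succ]
    exact length_output_le_wordStep _

theorem exists_run_eq_wordRun (hu : ∀ j, SeqPrefix (u j) (p j)) (t : ℕ) :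
    ∃ n, M.run p n = some (wordRun M t u).toConfig := by
  induction t with
  | zero => exact ⟨0, rfl⟩
  | succ t ih =>
    obtain ⟨n, hn⟩ := ih
    rw [wordRun_succ]
    rcases step_toConfig_or_wordStep_eq hu (wordRun M t u) with h | ⟨h, -⟩
    · exact ⟨n + 1, by rw [Type2Machine.run, hn]; exact h⟩
    · exact ⟨n, by rw [h, hn]⟩

theorem toConfig_wordRun (hu : ∀ j, SeqPrefix (u j) (p j)) {t : ℕ} (ht : ∀ j, t ≤ (u j).length)
    {c : M.Config} (hc : M.run p t = some c) :
    (wordRun M t u).toConfig = c ∧ ∀ j, (wordRun M t u).2.inPos j ≤ t := by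
  induction t generalizing c with
  | zero =>
    cases hc
    exact ⟨rfl, fun _ => le_rfl⟩
  | succ t ih =>
    rw [Type2Machine.run, Option.bind_eq_some_iff] at hc
    obtain ⟨_, hrun, hstep⟩ := hc
    obtain ⟨rfl, hpos⟩ := ih (fun j => (Nat.le_succ t).trans (ht j)) hrun
    rw [wordRun_succ]
    refine ⟨?_, fun j => (inPos_wordStep_le _ j).trans (Nat.succ_le_succ (hpos j))⟩
    rcases step_toConfig_or_wordStep_eq hu (wordRun M t u) with h | ⟨-, h | ⟨j, hj⟩⟩
    · exact Option.some.inj (h.symm.trans hstep)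
    · cases h.symm.trans hstep
    · exact absurd ((ht j).trans (hj.trans (hpos j))) (Nat.not_succ_le_self t)

namespace Type2Machine

theorem output_isPrefix_of_step {c c' : M.Config} (h : M.step p c = some c') :
    c.output <+: c'.output := by
  unfold step at h
  split at h <;> cases h <;> first | exact List.prefix_rfl | exact List.prefix_append _ _

theorem output_isPrefix_of_run {n n' : ℕ} (h : n ≤ n') {c c' : M.Config}
    (hc : M.run p n = some c) (hc' : M.run p n' = some c') : c.output <+: c'.output := by
  induction n', h using Nat.le_induction generalizing c' with
  | base =>
    cases hc.symm.trans hc'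
    exact List.prefix_rfl
  | succ n' _ ih =>
    rw [run, Option.bind_eq_some_iff] at hc'
    obtain ⟨c₁, hrun, hstep⟩ := hc'
    exact (ih hrun).trans (output_isPrefix_of_step hstep)

theorem YieldsSeq.seqPrefix {q : ℕ → σ} (h : M.YieldsSeq p q) {n : ℕ} {c : M.Config}
    (hc : M.run p n = some c) : SeqPrefix c.output q := by
  intro i a ha
  obtain ⟨n', c', hc', hi⟩ := h.2 i
  rcases le_total n n' with hn | hn
  · have ha' := getElem?_eq_some_of_isPrefix (output_isPrefix_of_run hn hc hc') ha
    exact Option.some.inj (hi.symm.trans ha')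
  · have hi' := getElem?_eq_some_of_isPrefix (output_isPrefix_of_run hn hc' hc) hi
    exact Option.some.inj (hi'.symm.trans ha)

theorem run_eq_none_of_halted {n n' : ℕ} (h : n < n') {c : M.Config} (hc : M.run p n = some c)
    (hhalt : M.step p c = none) : M.run p n' = none := by
  induction n', h using Nat.le_induction with
  | base => rw [run, hc, Option.bind_some, hhalt]
  | succ n' _ ih => rw [run, ih, Option.bind_none]

theorem halted_unique {n n' : ℕ} {c c' : M.Config} (hc : M.run p n = some c)
    (hhalt : M.step p c = none) (hc' : M.run p n' = some c') (hhalt' : M.step p c' = none) :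
    c = c' := by
  rcases lt_trichotomy n n' with h | rfl | h
  · cases (run_eq_none_of_halted h hc hhalt).symm.trans hc'
  · exact Option.some.inj (hc.symm.trans hc')
  · cases (run_eq_none_of_halted h hc' hhalt').symm.trans hc

end Type2Machine

theorem ComputableToSeq.exists_approximates [Primcodable σ] [Finite σ]
    {g : (Fin k → ℕ → σ) →. (ℕ → σ)} (hg : ComputableToSeq g) :
    ∃ h : ℕ → (Fin k → List σ) → List σ, Primrec₂ h ∧ ApproximatesSeq h g.toMultiFun := by
  obtain ⟨M, hM⟩ := hg
  refine ⟨fun t u => (wordRun M t u).2.output, primrec_output_wordRun M,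
    fun p q hq => ⟨fun t u hu => ?_, fun N => ?_⟩⟩
  · obtain ⟨n, hn⟩ := exists_run_eq_wordRun (M := M) hu t
    exact (hM p q hq).seqPrefix hn
  · obtain ⟨n, c, hc, hN⟩ := (hM p q hq).2 N
    refine ⟨n, fun t ht u hu => ?_⟩
    obtain ⟨rfl, -⟩ := toConfig_wordRun (fun j => (hu j).1) (fun j => (hu j).2) hc
    exact (List.getElem?_eq_some_iff.1 hN).1.le.trans (monotone_length_output_wordRun ht)

theorem ComputableToWord.exists_approximates [Primcodable σ] [Finite σ]
    {g : (Fin k → ℕ → σ) →. List σ} (hg : ComputableToWord g) :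
    ∃ h : ℕ → (Fin k → List σ) → Option (List σ), Primrec₂ h ∧
      ApproximatesWord h g.toMultiFun := by
  obtain ⟨M, hM⟩ := hg
  refine ⟨wordHaltOutput M, primrec_wordHaltOutput M, fun p w hw => ?_⟩
  obtain ⟨n, c, hc, hhalt, rfl⟩ := hM p w hw
  refine ⟨fun t u hu w hw => ?_, n, fun t ht u hu => ?_⟩
  · obtain ⟨n', hn'⟩ := exists_run_eq_wordRun (M := M) hu t
    rw [wordHaltOutput, Option.mem_def, Option.ite_none_right_eq_some] at hw
    obtain ⟨hhalt', hw⟩ := hw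
    rw [Type2Machine.halted_unique hc hhalt hn' (Type2Machine.step_eq_none_iff.2 hhalt')]
    exact (Option.some.inj hw).symm
  · obtain ⟨rfl, -⟩ := toConfig_wordRun (fun j => (hu j).1) (fun j => (hu j).2) hc
    have hhalt' : M.instr (wordRun M n u).1 = .halt := Type2Machine.step_eq_none_iff.1 hhalt
    rw [wordHaltOutput, wordRun_eq_of_halt ht hhalt', if_pos hhalt']
    rfl

end WordSimulation

/-! ### Replacing objects by names -/

section Cells

theorem eq_inl_iff_of_liftRel {α β γ : Type*} {R : β → γ → Prop} {x : α ⊕ β} {y : α ⊕ γ}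
    (h : Sum.LiftRel Eq R x y) (a : α) : x = .inl a ↔ y = .inl a := by
  cases h with
  | inl h => rw [h, Sum.inl.injEq, Sum.inl.injEq]
  | inr => exact iff_of_false Sum.inr_ne_inl Sum.inr_ne_inl

theorem exists_eq_inr_left_of_liftRel {α α' β β' : Type*} {R : α → α' → Prop}
    {R' : β → β' → Prop} {x : α ⊕ β} {b' : β'} (h : Sum.LiftRel R R' x (.inr b')) :
    ∃ b, x = .inr b ∧ R' b b' := by
  cases h with
  | inr h => exact ⟨_, rfl, h⟩

theorem exists_eq_inr_right_of_liftRel {α α' β β' : Type*} {R : α → α' → Prop}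
    {R' : β → β' → Prop} {b : β} {y : α' ⊕ β'} (h : Sum.LiftRel R R' (.inr b) y) :
    ∃ b', y = .inr b' ∧ R' b b' := by
  cases h with
  | inr h => exact ⟨_, rfl, h⟩

theorem forall_rel_update {ι κ : Type*} [DecidableEq ι] [DecidableEq κ] {A B : ι → Type*}
    {R : ∀ i, A i → B i → Prop} {f : ∀ i, κ → A i} {g : ∀ i, κ → B i}
    (h : ∀ i z, R i (f i z) (g i z)) {i : ι} (z : κ) {a : A i} {b : B i} (hab : R i a b)
    (i' : ι) (z' : κ) :
    R i' (Function.update f i (Function.update (f i) z a) i' z')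
      (Function.update g i (Function.update (g i) z b) i' z') := by
  by_cases hi : i' = i
  · subst hi
    by_cases hz : z' = z
    · subst hz
      simpa only [Function.update_self] using hab
    · simpa only [Function.update_self, Function.update_of_ne hz] using h i' z'
  · simpa only [Function.update_of_ne hi] using h i' z'

end Cells

section Names

variable {σ : Type s} {zero one : σ} {k L : ℕ} {Z : Fin (L + 1) → Type u}

/-- A statement on names realizes a statement on objects. -/
inductive StmtRealizes {Γ Lab : Type v} (δ : ∀ i, MultiRep σ (Z i)) :
    GTMStmt σ zero one (fun _ : Fin (L + 1) => ℕ → σ) Γ Lab →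
      GTMStmt σ zero one Z Γ Lab → Prop
  | right (i l') : StmtRealizes δ (.right i l') (.right i l')
  | left (i l') : StmtRealizes δ (.left i l') (.left i l')
  | write (i a l') : StmtRealizes δ (.write i a l') (.write i a l')
  | branch (i a l' l'') : StmtRealizes δ (.branch i a l' l'') (.branch i a l' l'')
  | assign {n : ℕ} (i) (idx : Fin n → Fin (L + 1)) (g f l')
      (h : Realizes (fun j => (δ (idx j)).toFun) (δ i).toFun g f) :
      StmtRealizes δ (.assign i idx g l') (.assign i idx f l')
  | test {n : ℕ} (idx : Fin n → Fin (L + 1)) (g : (Fin n → ℕ → σ) →. List σ) (hg)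
      (f : (∀ j, Z (idx j)) →. List σ) (hf l' l'')
      (h : Realizes (fun j => (δ (idx j)).toFun) (fun x : List σ => {x})
        g.toMultiFun f.toMultiFun) :
      StmtRealizes δ (.test idx g hg l' l'') (.test idx f hf l' l'')

/-- The machine with the labels and symbols of `P` whose statements `stm` work on names. -/
def GTM.onNames (P : GTM.{u, v, s} σ zero one k Z)
    (stm : ∀ l, l ≠ P.lf → GTMStmt σ zero one (fun _ : Fin (L + 1) => ℕ → σ) P.Γ P.Lab) :
    GTM.{s, v, s} σ zero one k (fun _ : Fin (L + 1) => ℕ → σ) where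
  Lab := P.Lab
  Γ := P.Γ
  finite_Lab := P.finite_Lab
  finite_Γ := P.finite_Γ
  k_le := P.k_le
  l₀ := P.l₀
  lf := P.lf
  blank := P.blank
  stm := stm

/-- Some computation from `c` reaches the final label with `q` in cell `0` of tape `0`. Unlike in
`GTM.fn`, other computations from `c` may fail to accept. -/
def GTM.OutputsFrom (P : GTM.{u, v, s} σ zero one k Z) (c : P.Config) (q : Z 0) : Prop :=
  ∃ d, Relation.ReflTransGen P.Step c d ∧ d.label = P.lf ∧ d.tape 0 0 = Sum.inr q

variable {P : GTM.{u, v, s} σ zero one k Z} {δ : ∀ i, MultiRep σ (Z i)}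

theorem GTM.AllAccepting.accepting {c₀ c : P.Config} (h : P.AllAccepting c₀)
    (hc : Relation.ReflTransGen P.Step c₀ c) (hl : c.label = P.lf) : P.Accepting c :=
  h.2 c hc fun ⟨_, hl', _⟩ => hl' hl

theorem GTM.AllAccepting.exists_step {c₀ c : P.Config} (h : P.AllAccepting c₀)
    (hc : Relation.ReflTransGen P.Step c₀ c) (hl : c.label ≠ P.lf) : ∃ d, P.Step c d := by
  by_contra hno
  exact hl (h.2 c hc hno).1

theorem GTM.AllAccepting.acc {c₀ : P.Config} (h : P.AllAccepting c₀) :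
    Acc (fun d c => P.Step c d) c₀ :=
  acc_iff_isEmpty_descending_chain.2 ⟨fun κ => h.1 ⟨κ.1, κ.2⟩⟩

variable {stm : ∀ l, l ≠ P.lf → GTMStmt σ zero one (fun _ : Fin (L + 1) => ℕ → σ) P.Γ P.Lab}

/-- A configuration on names describes a configuration on objects. -/
structure Describes (δ : ∀ i, MultiRep σ (Z i)) (c' : (P.onNames stm).Config) (c : P.Config) :
    Prop where
  label : c'.label = c.label
  head : c'.head = c.head
  tape : ∀ i z, Sum.LiftRel Eq (fun q x => x ∈ (δ i).toFun q) (c'.tape i z) (c.tape i z)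

namespace Describes

variable {c' d' : (P.onNames stm).Config} {c : P.Config}

theorem goto (h : Describes δ c' c) (l : P.Lab) : Describes δ (c'.goto l) (c.goto l) :=
  ⟨rfl, h.head, h.tape⟩

theorem setHead (h : Describes δ c' c) (i : Fin (L + 1)) (m : ℤ) :
    Describes δ (c'.setHead i m) (c.setHead i m) :=
  ⟨h.label, by simp only [GTM.Config.setHead, h.head], h.tape⟩

theorem setCell (h : Describes δ c' c) (i : Fin (L + 1)) {y' : P.Γ ⊕ (ℕ → σ)} {y : P.Γ ⊕ Z i}
    (hy : Sum.LiftRel Eq (fun q x => x ∈ (δ i).toFun q) y' y) :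
    Describes δ (c'.setCell i y') (c.setCell i y) := by
  refine ⟨h.label, h.head, ?_⟩
  simp only [GTM.Config.setCell, h.head]
  exact forall_rel_update (R := fun i => Sum.LiftRel Eq fun q x => x ∈ (δ i).toFun q) h.tape _ hy

theorem scan (h : Describes δ c' c) (i : Fin (L + 1)) :
    Sum.LiftRel Eq (fun q x => x ∈ (δ i).toFun q) (c'.scan i) (c.scan i) := by
  rw [GTM.Config.scan, h.head]
  exact h.tape i (c.head i)

theorem exists_names (h : Describes δ c' c) {n : ℕ} {idx : Fin n → Fin (L + 1)}
    {x : ∀ j, Z (idx j)} (hx : ∀ j, c.scan (idx j) = Sum.inr (x j)) :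
    ∃ q : Fin n → ℕ → σ, (∀ j, c'.scan (idx j) = Sum.inr (q j)) ∧
      ∀ j, x j ∈ (δ (idx j)).toFun (q j) :=
  Classical.skolem.1 (fun j => exists_eq_inr_left_of_liftRel (hx j ▸ h.scan (idx j))) |>.imp
    fun _ => forall_and.1

variable {s' : GTMStmt σ zero one (fun _ : Fin (L + 1) => ℕ → σ) P.Γ P.Lab}
  {s : GTMStmt σ zero one Z P.Γ P.Lab}

theorem exists_effect (h : Describes δ c' c) (hs : StmtRealizes δ s' s)
    (hc : ∃ d, P.Effect c d s) : ∃ d', (P.onNames stm).Effect c' d' s' := by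
  cases hs with
  | right | left | write => exact ⟨_, rfl⟩
  | branch i a l' l'' =>
    by_cases ha : c'.scan i = Sum.inl a
    · exact ⟨_, .inl ⟨ha, rfl⟩⟩
    · exact ⟨_, .inr ⟨ha, rfl⟩⟩
  | assign i idx g f l' hgf =>
    obtain ⟨_, x, hx, y, hy, -⟩ := hc
    obtain ⟨q, hq, hxq⟩ := h.exists_names hx
    obtain ⟨r, hr⟩ := (hgf _ x hxq ⟨y, hy⟩).1
    exact ⟨_, q, hq, r, hr, rfl⟩
  | test idx g hg f hf l' l'' hgf =>
    obtain ⟨_, x, hx, hfx⟩ := hc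
    obtain ⟨q, hq, hxq⟩ := h.exists_names hx
    obtain ⟨w, hw⟩ := (hgf _ x hxq (hfx.elim (⟨_, ·.1⟩) (⟨_, ·.1⟩))).1
    rcases hg _ w hw with rfl | rfl
    · exact ⟨_, q, hq, .inl ⟨hw, rfl⟩⟩
    · exact ⟨_, q, hq, .inr ⟨hw, rfl⟩⟩

/-- Off the domain of a function, its realization may take arbitrary values. -/
theorem effect (h : Describes δ c' c) (hs : StmtRealizes δ s' s)
    (hc : ∃ d, P.Effect c d s) (hd' : (P.onNames stm).Effect c' d' s') :
    ∃ d, P.Effect c d s ∧ Describes δ d' d := by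
  cases hs with
  | right i l' | left i l' =>
    obtain rfl := hd'
    refine ⟨_, rfl, ?_⟩
    rw [h.head]
    exact (h.setHead i _).goto l'
  | write i a l' =>
    obtain rfl := hd'
    exact ⟨_, rfl, (h.setCell i (.inl rfl)).goto l'⟩
  | branch i a l' l'' =>
    have hscan := eq_inl_iff_of_liftRel (h.scan i) a
    rcases hd' with ⟨ha, rfl⟩ | ⟨ha, rfl⟩
    · exact ⟨_, .inl ⟨hscan.1 ha, rfl⟩, h.goto l'⟩
    · exact ⟨_, .inr ⟨mt hscan.2 ha, rfl⟩, h.goto l''⟩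
  | assign i idx g f l' hgf =>
    obtain ⟨_, x, hx, y₀, hy₀, -⟩ := hc
    obtain ⟨q, hq, hxq⟩ := h.exists_names hx
    obtain ⟨q', hq', r, hr, rfl⟩ := hd'
    obtain rfl : q' = q := funext fun j => Sum.inr.inj ((hq' j).symm.trans (hq j))
    obtain ⟨y, hy, hyr⟩ := (hgf _ x hxq ⟨y₀, hy₀⟩).2 r hr
    exact ⟨_, ⟨x, hx, y, hy, rfl⟩, (h.setCell i (.inr hyr)).goto l'⟩
  | test idx g hg f hf l' l'' hgf =>
    obtain ⟨_, x, hx, hfx⟩ := hc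
    obtain ⟨q, hq, hxq⟩ := h.exists_names hx
    obtain ⟨q', hq', hd'⟩ := hd'
    obtain rfl : q' = q := funext fun j => Sum.inr.inj ((hq' j).symm.trans (hq j))
    have hval (w) (hw : w ∈ g q') : w ∈ f x := by
      obtain ⟨_, hw', rfl⟩ := (hgf _ x hxq (hfx.elim (⟨_, ·.1⟩) (⟨_, ·.1⟩))).2 w hw
      exact hw'
    rcases hd' with ⟨hw, rfl⟩ | ⟨hw, rfl⟩
    · exact ⟨_, ⟨x, hx, .inl ⟨hval _ hw, rfl⟩⟩, h.goto l'⟩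
    · exact ⟨_, ⟨x, hx, .inr ⟨hval _ hw, rfl⟩⟩, h.goto l''⟩

theorem stmtRealizes (hstm : ∀ l hl, StmtRealizes δ (stm l hl) (P.stm l hl))
    (h : Describes δ c' c) (hl' : c'.label ≠ P.lf) (hl : c.label ≠ P.lf) :
    StmtRealizes δ (stm c'.label hl') (P.stm c.label hl) := by
  obtain ⟨l', _, _⟩ := c'
  obtain ⟨l, _, _⟩ := c
  obtain rfl : l' = l := h.label
  exact hstm l' hl

theorem exists_step (hstm : ∀ l hl, StmtRealizes δ (stm l hl) (P.stm l hl))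
    (h : Describes δ c' c) (hc : ∃ d, P.Step c d) : ∃ d', (P.onNames stm).Step c' d' := by
  obtain ⟨d, hl, hd⟩ := hc
  have hl' : c'.label ≠ P.lf := h.label.trans_ne hl
  obtain ⟨d', hd'⟩ := h.exists_effect (h.stmtRealizes hstm hl' hl) ⟨d, hd⟩
  exact ⟨d', hl', hd'⟩

theorem step (hstm : ∀ l hl, StmtRealizes δ (stm l hl) (P.stm l hl)) (h : Describes δ c' c)
    (hc : ∃ d, P.Step c d) (hd' : (P.onNames stm).Step c' d') :
    ∃ d, P.Step c d ∧ Describes δ d' d := by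
  obtain ⟨d₀, hl, hd₀⟩ := hc
  obtain ⟨hl', hd'⟩ := hd'
  obtain ⟨d, hd, hd'd⟩ := h.effect (h.stmtRealizes hstm hl' hl) ⟨d₀, hd₀⟩ hd'
  exact ⟨d, ⟨hl, hd⟩, hd'd⟩

theorem exists_outputsFrom (hstm : ∀ l hl, StmtRealizes δ (stm l hl) (P.stm l hl))
    (h : Describes δ c' c) (hc : P.AllAccepting c) : ∃ q, (P.onNames stm).OutputsFrom c' q := by
  suffices ∀ d, Acc (fun d c => P.Step c d) d → Relation.ReflTransGen P.Step c d →
      ∀ d', Describes δ d' d → ∃ q, (P.onNames stm).OutputsFrom d' q from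
    this c hc.acc .refl c' h
  intro d hd
  induction hd with
  | intro d _ ih =>
    intro hcd d' hd'd
    by_cases hl : d.label = P.lf
    · obtain ⟨-, x, hx⟩ := hc.accepting hcd hl
      obtain ⟨q, hq, -⟩ := exists_eq_inr_left_of_liftRel (hx ▸ hd'd.tape 0 0)
      exact ⟨q, d', .refl, hd'd.label.trans hl, hq⟩
    · have hstep := hc.exists_step hcd hl
      obtain ⟨e', he'⟩ := hd'd.exists_step hstm hstep
      obtain ⟨e, he, he'e⟩ := hd'd.step hstm hstep he'
      obtain ⟨q, d'', hreach, hq⟩ := ih e he (hcd.tail he) e' he'e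
      exact ⟨q, d'', .head he' hreach, hq⟩

theorem reflTransGen (hstm : ∀ l hl, StmtRealizes δ (stm l hl) (P.stm l hl))
    (h : Describes δ c' c) (hc : P.AllAccepting c)
    (hd' : Relation.ReflTransGen (P.onNames stm).Step c' d') :
    ∃ d, Relation.ReflTransGen P.Step c d ∧ Describes δ d' d := by
  induction hd' with
  | refl => exact ⟨c, .refl, h⟩
  | @tail d' e' _ he' ih =>
    obtain ⟨d, hd, hd'd⟩ := ih
    have hl : d.label ≠ P.lf := hd'd.label.symm.trans_ne he'.1
    obtain ⟨e, he, he'e⟩ := hd'd.step hstm (hc.exists_step hd hl) he'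
    exact ⟨e, hd.tail he, he'e⟩

end Describes

theorem describes_initial {p : Fin k → ℕ → σ} {x : ∀ j, Z (P.inTape j)}
    (h : ∀ j, x j ∈ (δ (P.inTape j)).toFun (p j)) :
    Describes δ ((P.onNames stm).initial p) (P.initial x) := by
  refine ⟨rfl, rfl, fun i z => ?_⟩
  simp only [GTM.initial]
  by_cases hi : z = 0 ∧ 0 < i.val ∧ i.val ≤ k
  · rw [dif_pos hi, dif_pos hi]
    have hcast (j : Fin k) (i) (hj : P.inTape j = i) :
        cast (congrArg Z hj) (x j) ∈ (δ i).toFun (p j) := by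
      subst hj
      exact h j
    exact .inr (hcast ⟨i.val - 1, by omega⟩ i (Fin.ext (Nat.sub_add_cancel hi.2.1)))
  · rw [dif_neg hi, dif_neg hi]
    exact .inl rfl

theorem GTM.realizes_outputsFrom_initial
    (hstm : ∀ l hl, StmtRealizes δ (stm l hl) (P.stm l hl)) :
    Realizes (fun j => (δ (P.inTape j)).toFun) (δ 0).toFun
      (fun p => {q | (P.onNames stm).OutputsFrom ((P.onNames stm).initial p) q}) P.fn := by
  rintro p x hpx ⟨-, hacc, -⟩
  have hinit : Describes δ ((P.onNames stm).initial p) (P.initial x) := describes_initial hpx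
  refine ⟨hinit.exists_outputsFrom hstm hacc, ?_⟩
  rintro q ⟨d', hd', hl, hq⟩
  obtain ⟨d, hd, hd'd⟩ := hinit.reflTransGen hstm hacc hd'
  obtain ⟨y, hy, hyq⟩ := exists_eq_inr_right_of_liftRel (hq ▸ hd'd.tape 0 0)
  exact ⟨y, ⟨hacc, d, hd, ⟨hd'd.label.symm.trans hl, y, hy⟩, hy⟩, hyq⟩

end Names

/-! ### Approximation of machines on names by machines on words -/

section WordMachine

variable {σ : Type s} {zero one : σ} {k L : ℕ} {Γ Lab : Type v}

/-- Statements of a machine whose cells contain words instead of sequences. They are executed with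
a precision, which is the first argument of the functions in assignments and tests. -/
inductive ApproxStmt (σ : Type s) (L : ℕ) (Γ Lab : Type v)
  | right (i : Fin (L + 1)) (l' : Lab)
  | left (i : Fin (L + 1)) (l' : Lab)
  | write (i : Fin (L + 1)) (a : Γ) (l' : Lab)
  | branch (i : Fin (L + 1)) (a : Γ) (l' l'' : Lab)
  /-- write the value of `h` at the current precision -/
  | assign {n : ℕ} (i : Fin (L + 1)) (idx : Fin n → Fin (L + 1))
      (h : ℕ → (Fin n → List σ) → List σ) (l' : Lab)
  /-- branch on the value of `h` at the current precision; no action if there is none -/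
  | test {n : ℕ} (idx : Fin n → Fin (L + 1)) (h : ℕ → (Fin n → List σ) → Option (List σ))
      (l' l'' : Lab)

/-- A statement on words approximates a statement on names. -/
inductive StmtApproximates :
    ApproxStmt σ L Γ Lab → GTMStmt σ zero one (fun _ : Fin (L + 1) => ℕ → σ) Γ Lab → Prop
  | right (i l') : StmtApproximates (.right i l') (.right i l')
  | left (i l') : StmtApproximates (.left i l') (.left i l')
  | write (i a l') : StmtApproximates (.write i a l') (.write i a l')
  | branch (i a l' l'') : StmtApproximates (.branch i a l' l'') (.branch i a l' l'')
  | assign {n : ℕ} (i) (idx : Fin n → Fin (L + 1)) (h : ℕ → (Fin n → List σ) → List σ)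
      (g : MultiFun (Fin n → ℕ → σ) (ℕ → σ)) (l') (hg : ApproximatesSeq h g) :
      StmtApproximates (.assign i idx h l') (.assign i idx g l')
  | test {n : ℕ} (idx : Fin n → Fin (L + 1)) (h : ℕ → (Fin n → List σ) → Option (List σ))
      (g : (Fin n → ℕ → σ) →. List σ) (hval l' l'') (hg : ApproximatesWord h g.toMultiFun) :
      StmtApproximates (.test idx h l' l'') (.test idx g hval l' l'')

/-- All functions in the statement are primitive recursive. -/
def ApproxStmt.IsPrimrec [Primcodable σ] : ApproxStmt σ L Γ Lab → Prop
  | .assign _ _ h _ => Primrec₂ h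
  | .test _ h _ _ => Primrec₂ h
  | _ => True

/-- The word in a cell. The junk value for a symbol of the work alphabet is the empty word. -/
def cellWord (x : Γ ⊕ List σ) : List σ := x.elim (fun _ => []) id

/-- The tape inscriptions and head positions of a machine whose cells contain words. -/
abbrev ApproxData (σ : Type s) (L : ℕ) (Γ : Type v) :=
  TapeLog (L + 1) (Γ ⊕ List σ) × (Fin (L + 1) → ℤ)

/-- The content of the cell scanned by the head of tape `i`. -/
def ApproxData.scan (blank : Γ) (d : ApproxData σ L Γ) (i : Fin (L + 1)) : Γ ⊕ List σ :=
  d.1.get (.inl blank) i (d.2 i)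

/-- The words scanned by the heads of the tapes `idx`. -/
def ApproxData.words (blank : Γ) (d : ApproxData σ L Γ) {n : ℕ} (idx : Fin n → Fin (L + 1)) :
    Fin n → List σ :=
  fun j => cellWord (d.scan blank (idx j))

/-- Write `y` under the head of tape `i`. -/
def ApproxData.setCell (d : ApproxData σ L Γ) (i : Fin (L + 1)) (y : Γ ⊕ List σ) :
    ApproxData σ L Γ :=
  (((i, d.2 i), y) :: d.1, d.2)

open Classical in
/-- Execute a statement at label `l` with precision `t`. A test whose value is not known at this
precision stays at `l`, to be tried again with longer words. Known values are compared with the word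
`[zero]` only. -/
noncomputable def approxExec (zero : σ) (blank : Γ) (l : Lab) (t : ℕ) (d : ApproxData σ L Γ) :
    ApproxStmt σ L Γ Lab → Lab × ApproxData σ L Γ
  | .right i l' => (l', d.1, Function.update d.2 i (d.2 i + 1))
  | .left i l' => (l', d.1, Function.update d.2 i (d.2 i - 1))
  | .write i a l' => (l', d.setCell i (.inl a))
  | .branch i a l' l'' => (if d.scan blank i = .inl a then l' else l'', d)
  | .assign i idx h l' => (l', d.setCell i (.inr (h t (d.words blank idx))))
  | .test idx h l' l'' =>
      (((h t (d.words blank idx)).map fun w => if w = [zero] then l' else l'').getD l, d)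

section Primrec

variable [Primcodable σ] [Primcodable Γ]

theorem primrec_cellWord : Primrec (cellWord : Γ ⊕ List σ → List σ) :=
  (Primrec.sumCasesOn .id ((Primrec.const []).comp₂ .right) .right).of_eq fun x => by
    cases x <;> rfl

theorem ApproxData.primrec_scan (blank : Γ) (i : Fin (L + 1)) :
    Primrec fun d : ApproxData σ L Γ => d.scan blank i :=
  (TapeLog.primrec_get _ i).comp .fst ((primrec_apply i).comp .snd)

theorem ApproxData.primrec_words (blank : Γ) {n : ℕ} (idx : Fin n → Fin (L + 1)) :
    Primrec fun d : ApproxData σ L Γ => d.words blank idx :=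
  Primrec.fin_curry.2 <| Primrec₂.swap <| Primrec.fin_curry₁.2 fun j =>
    primrec_cellWord.comp (primrec_scan blank (idx j))

theorem ApproxData.primrec_setCell (i : Fin (L + 1)) :
    Primrec₂ fun (d : ApproxData σ L Γ) y => d.setCell i y :=
  Primrec.pair (Primrec.list_cons.comp (Primrec.pair (Primrec.pair (.const i)
    ((primrec_apply i).comp (Primrec.snd.comp .fst))) .snd) (Primrec.fst.comp .fst))
    (Primrec.snd.comp .fst)

theorem primrec_approxExec [Primcodable Lab] (zero : σ) (blank : Γ) (l : Lab)
    (I : ApproxStmt σ L Γ Lab) (hI : I.IsPrimrec) :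
    Primrec fun x : ℕ × ApproxData σ L Γ => approxExec zero blank l x.1 x.2 I := by
  classical
  have hlog : Primrec fun x : ℕ × ApproxData σ L Γ => x.2.1 := Primrec.fst.comp .snd
  have hhead : Primrec fun x : ℕ × ApproxData σ L Γ => x.2.2 := Primrec.snd.comp .snd
  have hheadAt (i : Fin (L + 1)) := (primrec_apply i).comp hhead
  cases I with
  | right i l' =>
    exact .pair (.const l') (.pair hlog
      ((primrec_update i).comp hhead (primrec_int_add_one.comp (hheadAt i))))
  | left i l' =>
    exact .pair (.const l') (.pair hlog
      ((primrec_update i).comp hhead (primrec_int_sub_one.comp (hheadAt i))))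
  | write i a l' =>
    exact .pair (.const l') ((ApproxData.primrec_setCell i).comp .snd (.const _))
  | branch i a l' l'' =>
    have hscan : Primrec fun x : ℕ × ApproxData σ L Γ => x.2.scan blank i :=
      (ApproxData.primrec_scan blank i).comp .snd
    exact .pair (Primrec.ite (Primrec.eq.comp hscan (.const _)) (.const l') (.const l'')) .snd
  | assign i idx h l' =>
    have hh : Primrec₂ h := hI
    exact .pair (.const l') ((ApproxData.primrec_setCell i).comp .snd (Primrec.sumInr.comp
      (hh.comp .fst ((ApproxData.primrec_words blank idx).comp .snd))))
  | test idx h l' l'' =>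
    have hh : Primrec₂ h := hI
    have hnext : Primrec fun w : List σ => if w = [zero] then l' else l'' :=
      Primrec.ite (Primrec.eq.comp .id (.const _)) (.const l') (.const l'')
    exact .pair (Primrec.option_getD.comp (Primrec.option_map
      (hh.comp .fst ((ApproxData.primrec_words blank idx).comp .snd)) (hnext.comp₂ .right))
      (.const l)) .snd

end Primrec

/-- A cell with a word or symbol describes a cell with a sequence or symbol: symbols agree, and
words are prefixes of length at least `M`. -/
abbrev CellApprox (M : ℕ) : Γ ⊕ List σ → Γ ⊕ (ℕ → σ) → Prop :=
  Sum.LiftRel Eq fun w q => SeqPrefix w q ∧ M ≤ w.length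

theorem CellApprox.cellWord {M : ℕ} {x : Γ ⊕ List σ} {q : ℕ → σ}
    (h : CellApprox M x (.inr q)) : SeqPrefix (cellWord x) q ∧ M ≤ (cellWord x).length := by
  obtain ⟨w, rfl, hw⟩ := exists_eq_inr_left_of_liftRel h
  exact hw

variable (N : GTM.{s, v, s} σ zero one k (fun _ : Fin (L + 1) => ℕ → σ))
  (prog : ∀ l, l ≠ N.lf → ApproxStmt σ L N.Γ N.Lab)

/-- The configurations of the machine on words with the labels and symbols of `N`. -/
abbrev ApproxConfig := N.Lab × ApproxData σ L N.Γ

open Classical in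
/-- One step of the machine on words with precision `t`; nothing happens at the final label. -/
noncomputable def approxStep (t : ℕ) (c : ApproxConfig N) : ApproxConfig N :=
  if hl : c.1 = N.lf then c else approxExec zero N.blank c.1 t c.2 (prog c.1 hl)

/-- The initial configuration of the machine on words for the input words `u`. -/
def approxInit (u : Fin k → List σ) : ApproxConfig N :=
  (N.l₀, List.ofFn fun j => ((N.inTape j, 0), .inr (u j)), fun _ => 0)

/-- The configuration after `n` steps with precision `t` on the input words `u`. -/
noncomputable def approxRun (t : ℕ) (u : Fin k → List σ) (n : ℕ) : ApproxConfig N :=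
  (approxStep N prog t)^[n] (approxInit N u)

open Classical in
/-- The word computed within `t` steps with precision `t`; it is empty if the final label is not
reached. -/
noncomputable def approxOutput (t : ℕ) (u : Fin k → List σ) : List σ :=
  if (approxRun N prog t u t).1 = N.lf then
    cellWord ((approxRun N prog t u t).2.1.get (.inl N.blank) 0 0)
  else []

variable {N prog}

theorem approxStep_of_final {t : ℕ} {c : ApproxConfig N} (hc : c.1 = N.lf) :
    approxStep N prog t c = c :=
  dif_pos hc

theorem approxRun_succ (t : ℕ) (u : Fin k → List σ) (n : ℕ) :
    approxRun N prog t u (n + 1) = approxStep N prog t (approxRun N prog t u n) :=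
  Function.iterate_succ_apply' _ _ _

theorem approxRun_eq_of_final {t : ℕ} {u : Fin k → List σ} {n n' : ℕ} (hn : n ≤ n')
    (hl : (approxRun N prog t u n).1 = N.lf) :
    approxRun N prog t u n' = approxRun N prog t u n := by
  induction n', hn using Nat.le_induction with
  | base => rfl
  | succ n' _ ih => rw [approxRun_succ, ih, approxStep_of_final hl]

theorem primrec_approxStep [Primcodable σ] [Primcodable N.Lab] [Primcodable N.Γ]
    (hprog : ∀ l hl, (prog l hl).IsPrimrec) : Primrec₂ (approxStep N prog) := by
  have := N.finite_Lab
  have hstep : Primrec₂ fun (l : N.Lab) (x : ℕ × ApproxData σ L N.Γ) =>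
      approxStep N prog x.1 (l, x.2) := by
    refine primrec₂_of_finite fun l => ?_
    by_cases hl : l = N.lf
    · exact (Primrec.pair (.const l) .snd).of_eq fun x => (approxStep_of_final hl).symm
    · exact (primrec_approxExec zero N.blank l _ (hprog l hl)).of_eq fun x => by
        rw [approxStep, dif_neg hl]
  exact hstep.comp (Primrec.fst.comp .snd) (.pair .fst (Primrec.snd.comp .snd))

theorem primrec_approxOutput [Primcodable σ] (hprog : ∀ l hl, (prog l hl).IsPrimrec) :
    Primrec₂ (approxOutput N prog) := by
  classical
  have := N.finite_Lab
  have := N.finite_Γ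
  let _ := primcodableOfFinite N.Lab
  let _ := primcodableOfFinite N.Γ
  have hinit : Primrec (approxInit N) := .pair (.const _) (.pair (Primrec.list_ofFn fun j =>
    .pair (.const _) (Primrec.sumInr.comp (primrec_apply j))) (.const _))
  have hrun : Primrec₂ fun t u => approxRun N prog t u t :=
    Primrec.nat_iterate .fst (hinit.comp .snd)
      ((primrec_approxStep hprog).comp (Primrec.fst.comp .fst) .snd)
  have hword := primrec_cellWord.comp ((TapeLog.primrec_get (Sum.inl N.blank) 0).comp
    (Primrec.fst.comp (Primrec.snd.comp hrun)) (.const 0))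
  exact (Primrec.ite (Primrec.eq.comp (Primrec.fst.comp hrun) (.const N.lf)) hword
    (.const [])).of_eq fun _ => by simp only [approxOutput]

/-- A configuration of the machine on words describes a configuration of the machine on names, with
words of length at least `M`. -/
structure ConfApprox (M : ℕ) (c : ApproxConfig N) (d : N.Config) : Prop where
  label : c.1 = d.label
  head : c.2.2 = d.head
  tape : ∀ i z, CellApprox M (c.2.1.get (.inl N.blank) i z) (d.tape i z)

theorem confApprox_init {M : ℕ} {u : Fin k → List σ} {p : Fin k → ℕ → σ}
    (hu : ∀ j, SeqPrefix (u j) (p j) ∧ M ≤ (u j).length) :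
    ConfApprox M (approxInit N u) (N.initial p) := by
  refine ⟨rfl, rfl, fun i z => TapeLog.get_induction
    (R := fun x => CellApprox M x ((N.initial p).tape i z)) (fun x hx hxi => ?_) fun hx => ?_⟩
  · obtain ⟨j, rfl⟩ := List.mem_ofFn.1 hx
    obtain ⟨rfl, rfl⟩ := Prod.ext_iff.1 hxi
    have hcell : (N.initial p).tape (N.inTape j) 0 = .inr (p j) :=
      dif_pos ⟨rfl, Nat.succ_pos _, j.2⟩
    exact hcell ▸ .inr (hu j)
  · have hcell : (N.initial p).tape i z = .inl N.blank := by
      refine dif_neg ?_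
      rintro ⟨rfl, hpos, hk⟩
      exact hx _ (List.mem_ofFn.2 ⟨⟨i.val - 1, by omega⟩, rfl⟩)
        (Prod.ext (Fin.ext (Nat.sub_add_cancel hpos)) rfl)
    exact hcell ▸ .inl rfl

namespace ConfApprox

variable {M : ℕ} {c : ApproxConfig N} {d d' : N.Config}

theorem mono {M' : ℕ} (h : ConfApprox M' c d) (hM : M ≤ M') : ConfApprox M c d :=
  ⟨h.label, h.head, fun i z => (h.tape i z).mono (fun _ _ => id) fun _ _ => .imp_right hM.trans⟩

theorem scan (h : ConfApprox M c d) (i : Fin (L + 1)) :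
    CellApprox M (c.2.scan N.blank i) (d.scan i) := by
  rw [ApproxData.scan, h.head]
  exact h.tape i _

theorem words (h : ConfApprox M c d) {n : ℕ} {idx : Fin n → Fin (L + 1)} {x : Fin n → ℕ → σ}
    (hx : ∀ j, d.scan (idx j) = .inr (x j)) (j : Fin n) :
    SeqPrefix (c.2.words N.blank idx j) (x j) ∧ M ≤ (c.2.words N.blank idx j).length :=
  CellApprox.cellWord (hx j ▸ h.scan (idx j))

theorem goto (h : ConfApprox M c d) (l : N.Lab) : ConfApprox M (l, c.2) (d.goto l) :=
  ⟨rfl, h.head, h.tape⟩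

theorem setHead (h : ConfApprox M c d) (i : Fin (L + 1)) (m : ℤ) :
    ConfApprox M (c.1, c.2.1, Function.update c.2.2 i m) (d.setHead i m) :=
  ⟨h.label, by simp only [GTM.Config.setHead, h.head], h.tape⟩

theorem setCell (h : ConfApprox M c d) (i : Fin (L + 1)) {y : N.Γ ⊕ List σ}
    {y' : N.Γ ⊕ (ℕ → σ)} (hy : CellApprox M y y') :
    ConfApprox M (c.1, c.2.setCell i y) (d.setCell i y') := by
  refine ⟨h.label, h.head, ?_⟩
  simp only [ApproxData.setCell, GTM.Config.setCell, TapeLog.get_cons, h.head]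
  exact forall_rel_update (R := fun _ => CellApprox M) h.tape _ hy

theorem exec_right (h : ConfApprox M c d) (t : ℕ) (i : Fin (L + 1)) (l' : N.Lab) :
    ConfApprox M (approxExec zero N.blank c.1 t c.2 (.right i l'))
      ((d.setHead i (d.head i + 1)).goto l') := by
  rw [← h.head]
  exact (h.setHead i _).goto l'

theorem exec_left (h : ConfApprox M c d) (t : ℕ) (i : Fin (L + 1)) (l' : N.Lab) :
    ConfApprox M (approxExec zero N.blank c.1 t c.2 (.left i l'))
      ((d.setHead i (d.head i - 1)).goto l') := by
  rw [← h.head]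
  exact (h.setHead i _).goto l'

theorem exec_branch (h : ConfApprox M c d) (t : ℕ) {i : Fin (L + 1)} {a : N.Γ} {l' l'' : N.Lab}
    (hd : N.Effect d d' (.branch i a l' l'')) :
    ConfApprox M (approxExec zero N.blank c.1 t c.2 (.branch i a l' l'')) d' := by
  have hscan := eq_inl_iff_of_liftRel (h.scan i) a
  rw [approxExec]
  rcases hd with ⟨ha, rfl⟩ | ⟨ha, rfl⟩
  · rw [if_pos (hscan.2 ha)]
    exact h.goto l'
  · rw [if_neg (mt hscan.1 ha)]
    exact h.goto l''

theorem exec_test (h01 : zero ≠ one) (h : ConfApprox M c d) {t n : ℕ}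
    {idx : Fin n → Fin (L + 1)} {f : ℕ → (Fin n → List σ) → Option (List σ)} {w : List σ}
    {l' l'' : N.Lab} (hf : f t (c.2.words N.blank idx) = some w)
    (hd : w = [zero] ∧ d' = d.goto l' ∨ w = [one] ∧ d' = d.goto l'') :
    ConfApprox M (approxExec zero N.blank c.1 t c.2 (.test idx f l' l'')) d' := by
  rw [approxExec, hf, Option.map_some, Option.getD_some]
  rcases hd with ⟨rfl, rfl⟩ | ⟨rfl, rfl⟩
  · rw [if_pos rfl]
    exact h.goto l'
  · rw [if_neg fun h10 => h01 (List.singleton_inj.1 h10).symm]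
    exact h.goto l''

variable {I : ApproxStmt σ L N.Γ N.Lab}
  {S : GTMStmt σ zero one (fun _ : Fin (L + 1) => ℕ → σ) N.Γ N.Lab}

theorem exec_eq_or (h01 : zero ≠ one) (h : ConfApprox 0 c d) (hIS : StmtApproximates I S)
    (hd : N.Effect d d' S) (t : ℕ) :
    approxExec zero N.blank c.1 t c.2 I = c ∨
      ConfApprox 0 (approxExec zero N.blank c.1 t c.2 I) d' := by
  cases hIS with
  | right i l' => exact .inr (hd ▸ h.exec_right t i l')
  | left i l' => exact .inr (hd ▸ h.exec_left t i l')
  | write i a l' => exact .inr (hd ▸ (h.setCell i (.inl rfl)).goto l')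
  | branch i a l' l'' => exact .inr (h.exec_branch t hd)
  | assign i idx f g l' hg =>
    obtain ⟨x, hx, y, hy, rfl⟩ := hd
    have hpre := (hg x y hy).1 t _ fun j => (h.words hx j).1
    exact .inr ((h.setCell i (.inr ⟨hpre, Nat.zero_le _⟩)).goto l')
  | test idx f g hval l' l'' hg =>
    obtain ⟨x, hx, hd⟩ := hd
    cases hf : f t (c.2.words N.blank idx) with
    | none =>
      left
      rw [approxExec, hf]
      rfl
    | some w =>
      have hw (w') (hw' : w' ∈ g x) : w = w' :=
        (hg x w' hw').1 t _ (fun j => (h.words hx j).1) w hf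
      exact .inr (h.exec_test h01 hf (hd.imp (.imp_left (hw _)) (.imp_left (hw _))))

theorem exists_exec (h01 : zero ≠ one) (hIS : StmtApproximates I S) (hd : N.Effect d d' S)
    (M : ℕ) :
    ∃ M', ∀ t ≥ M', ∀ c, ConfApprox M' c d →
      ConfApprox M (approxExec zero N.blank c.1 t c.2 I) d' := by
  cases hIS with
  | right i l' => exact ⟨M, fun t _ c h => hd ▸ h.exec_right t i l'⟩
  | left i l' => exact ⟨M, fun t _ c h => hd ▸ h.exec_left t i l'⟩
  | write i a l' => exact ⟨M, fun t _ c h => hd ▸ (h.setCell i (.inl rfl)).goto l'⟩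
  | branch i a l' l'' => exact ⟨M, fun t _ c h => h.exec_branch t hd⟩
  | assign i idx f g l' hg =>
    obtain ⟨x, hx, y, hy, rfl⟩ := hd
    obtain ⟨hpre, hlength⟩ := hg x y hy
    obtain ⟨t₀, ht₀⟩ := hlength M
    refine ⟨max M t₀, fun t ht c h => ?_⟩
    have hwords := (h.mono (le_max_right M t₀)).words hx
    exact ((h.mono (le_max_left M t₀)).setCell i (.inr ⟨hpre t _ fun j => (hwords j).1,
      ht₀ t ((le_max_right M t₀).trans ht) _ hwords⟩)).goto l'
  | test idx f g hval l' l'' hg =>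
    obtain ⟨x, hx, hd⟩ := hd
    obtain ⟨w, hw⟩ : ∃ w, w ∈ g x := hd.elim (⟨_, ·.1⟩) (⟨_, ·.1⟩)
    obtain ⟨t₀, ht₀⟩ := (hg x w hw).2
    refine ⟨max M t₀, fun t ht c h => ?_⟩
    have hf := ht₀ t ((le_max_right M t₀).trans ht) _ ((h.mono (le_max_right M t₀)).words hx)
    exact (h.mono (le_max_left M t₀)).exec_test h01 hf
      (hd.imp (.imp_left (Part.mem_unique hw)) (.imp_left (Part.mem_unique hw)))

theorem step_eq_or (h01 : zero ≠ one)
    (hprog : ∀ l hl, StmtApproximates (prog l hl) (N.stm l hl)) (h : ConfApprox 0 c d)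
    (hd : N.Step d d') (t : ℕ) :
    approxStep N prog t c = c ∨ ConfApprox 0 (approxStep N prog t c) d' := by
  obtain ⟨l, data⟩ := c
  obtain rfl : l = d.label := h.label
  obtain ⟨hl, hd⟩ := hd
  rw [approxStep, dif_neg hl]
  exact h.exec_eq_or h01 (hprog _ hl) hd t

theorem exists_step (h01 : zero ≠ one)
    (hprog : ∀ l hl, StmtApproximates (prog l hl) (N.stm l hl)) (hd : N.Step d d') (M : ℕ) :
    ∃ M', ∀ t ≥ M', ∀ c, ConfApprox M' c d → ConfApprox M (approxStep N prog t c) d' := by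
  obtain ⟨hl, hd⟩ := hd
  obtain ⟨M', hM'⟩ := exists_exec h01 (hprog _ hl) hd M
  refine ⟨M', fun t ht ⟨l, data⟩ h => ?_⟩
  obtain rfl : l = d.label := h.label
  rw [approxStep, dif_neg hl]
  exact hM' t ht _ h

end ConfApprox

variable {p : Fin k → ℕ → σ} {d : N.Config}

/-- The machine on words lags behind the computation on names, and never leaves it. -/
theorem exists_reflTransGen_confApprox (h01 : zero ≠ one)
    (hprog : ∀ l hl, StmtApproximates (prog l hl) (N.stm l hl)) {u : Fin k → List σ}
    (hu : ∀ j, SeqPrefix (u j) (p j)) (hd : Relation.ReflTransGen N.Step (N.initial p) d)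
    (hl : d.label = N.lf) (t n : ℕ) :
    ∃ e, Relation.ReflTransGen N.Step e d ∧ ConfApprox 0 (approxRun N prog t u n) e := by
  induction n with
  | zero => exact ⟨_, hd, confApprox_init fun j => ⟨hu j, Nat.zero_le _⟩⟩
  | succ n ih =>
    obtain ⟨e, hed, he⟩ := ih
    rw [approxRun_succ]
    rcases hed.cases_head with rfl | ⟨e', hstep, he'd⟩
    · exact ⟨e, hed, (approxStep_of_final (he.label.trans hl)).symm ▸ he⟩
    · rcases he.step_eq_or h01 hprog hstep t with heq | he'
      · exact ⟨e, hed, heq.symm ▸ he⟩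
      · exact ⟨e', he'd, he'⟩

theorem exists_confApprox_approxRun (h01 : zero ≠ one)
    (hprog : ∀ l hl, StmtApproximates (prog l hl) (N.stm l hl))
    (hd : Relation.ReflTransGen N.Step (N.initial p) d) :
    ∃ n, ∀ M, ∃ t₀, ∀ t ≥ t₀, ∀ u, (∀ j, SeqPrefix (u j) (p j) ∧ t₀ ≤ (u j).length) →
      ConfApprox M (approxRun N prog t u n) d := by
  induction hd with
  | refl => exact ⟨0, fun M => ⟨M, fun t _ u hu => confApprox_init hu⟩⟩
  | tail _ hstep ih =>
    obtain ⟨n, hn⟩ := ih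
    refine ⟨n + 1, fun M => ?_⟩
    obtain ⟨M', hM'⟩ := ConfApprox.exists_step h01 hprog hstep M
    obtain ⟨t₀, ht₀⟩ := hn M'
    refine ⟨max t₀ M', fun t ht u hu => ?_⟩
    rw [approxRun_succ]
    exact hM' t ((le_max_right _ _).trans ht) _ (ht₀ t ((le_max_left _ _).trans ht) u
      fun j => (hu j).imp_right (le_max_left _ _).trans)

theorem seqPrefix_approxOutput (h01 : zero ≠ one)
    (hprog : ∀ l hl, StmtApproximates (prog l hl) (N.stm l hl)) {u : Fin k → List σ}
    (hu : ∀ j, SeqPrefix (u j) (p j)) {q : ℕ → σ} (hq : N.OutputsFrom (N.initial p) q) (t : ℕ) :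
    SeqPrefix (approxOutput N prog t u) q := by
  obtain ⟨d, hd, hl, hq⟩ := hq
  obtain ⟨e, hed, he⟩ := exists_reflTransGen_confApprox h01 hprog hu hd hl t t
  unfold approxOutput
  split_ifs with hfinal
  · rcases hed.cases_head with rfl | ⟨_, ⟨he', -⟩, -⟩
    · exact (CellApprox.cellWord (hq ▸ he.tape 0 0)).1
    · exact absurd (he.label.symm.trans hfinal) he'
  · simp [SeqPrefix]

theorem exists_le_length_approxOutput (h01 : zero ≠ one)
    (hprog : ∀ l hl, StmtApproximates (prog l hl) (N.stm l hl)) {q : ℕ → σ}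
    (hq : N.OutputsFrom (N.initial p) q) (M : ℕ) :
    ∃ t₀, ∀ t ≥ t₀, ∀ u, (∀ j, SeqPrefix (u j) (p j) ∧ t₀ ≤ (u j).length) →
      M ≤ (approxOutput N prog t u).length := by
  obtain ⟨d, hd, hl, hq⟩ := hq
  obtain ⟨n, hn⟩ := exists_confApprox_approxRun h01 hprog hd
  obtain ⟨t₀, ht₀⟩ := hn M
  refine ⟨max t₀ n, fun t ht u hu => ?_⟩
  have hrun := ht₀ t ((le_max_left _ _).trans ht) u
    fun j => (hu j).imp_right (le_max_left _ _).trans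
  have hfinal := hrun.label.trans hl
  rw [approxOutput, approxRun_eq_of_final ((le_max_right _ _).trans ht) hfinal, if_pos hfinal]
  exact (CellApprox.cellWord (hq ▸ hrun.tape 0 0)).2

theorem approximatesSeq_approxOutput (h01 : zero ≠ one)
    (hprog : ∀ l hl, StmtApproximates (prog l hl) (N.stm l hl)) :
    ApproximatesSeq (approxOutput N prog) fun p => {q | N.OutputsFrom (N.initial p) q} :=
  fun _ _ hq => ⟨fun t _ hu => seqPrefix_approxOutput h01 hprog hu hq t,
    exists_le_length_approxOutput h01 hprog hq⟩

end WordMachine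

/-! ### Closure under programming -/

section Closure

/-- A partial function that selects a value of a multi-function wherever there is one. -/
noncomputable def MultiFun.selection {A B : Type*} (F : MultiFun A B) : A →. B := fun a =>
  ⟨(F a).Nonempty, fun h => h.some⟩

theorem MultiFun.mem_of_mem_selection {A B : Type*} {F : MultiFun A B} {a : A} {b : B}
    (hb : b ∈ F.selection.toMultiFun a) : b ∈ F a := by
  obtain ⟨h, rfl⟩ := hb
  exact h.some_mem

theorem Realizes.selection {n : ℕ} {X Y : Fin n → Type*} {X₀ Y₀ : Type*}
    {γ : ∀ i, MultiFun (X i) (Y i)} {γ₀ : MultiFun X₀ Y₀} {f : MultiFun (∀ i, X i) X₀}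
    {g : MultiFun (∀ i, Y i) Y₀} (h : Realizes γ γ₀ f g) :
    Realizes γ γ₀ f.selection.toMultiFun g := fun x y hxy hy =>
  ⟨⟨_, (h x y hxy hy).1, rfl⟩, fun x₀ hx₀ =>
    (h x y hxy hy).2 x₀ (MultiFun.mem_of_mem_selection hx₀)⟩

variable {σ : Type s} {zero one : σ} {k L : ℕ} {Z : Fin (L + 1) → Type u} {Γ Lab : Type v}

theorem ApproximatesSeq.selection {n : ℕ} {h : ℕ → (Fin n → List σ) → List σ}
    {g : MultiFun (Fin n → ℕ → σ) (ℕ → σ)} (hg : ApproximatesSeq h g) :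
    ApproximatesSeq h g.selection.toMultiFun := fun p q hq =>
  hg p q (MultiFun.mem_of_mem_selection hq)

theorem exists_stmtRealizes_test {δ : ∀ i, MultiRep σ (Z i)} {n : ℕ}
    {idx : Fin n → Fin (L + 1)} {f : (∀ j, Z (idx j)) →. List σ}
    (hf : ∀ x, ∀ y ∈ f x, y = [zero] ∨ y = [one]) {g : (Fin n → ℕ → σ) →. List σ}
    (hgf : Realizes (fun j => (δ (idx j)).toFun) (fun x : List σ => {x})
      g.toMultiFun f.toMultiFun)
    {h : ℕ → (Fin n → List σ) → Option (List σ)} (hg : ApproximatesWord h g.toMultiFun)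
    (l' l'' : Lab) :
    ∃ S : GTMStmt σ zero one (fun _ : Fin (L + 1) => ℕ → σ) Γ Lab,
      StmtRealizes δ S (.test idx f hf l' l'') ∧ StmtApproximates (.test idx h l' l'') S := by
  -- Off the names of arguments of `f`, the realizer `g` may have values that a test cannot have.
  let g' : (Fin n → ℕ → σ) →. List σ := fun p =>
    ⟨∃ w ∈ g p, w = [zero] ∨ w = [one], fun hw => hw.choose⟩
  have hg' : ∀ p, ∀ w ∈ g' p, w ∈ g p ∧ (w = [zero] ∨ w = [one]) := by
    rintro p w ⟨hw, rfl⟩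
    exact hw.choose_spec
  refine ⟨.test idx g' (fun p w hw => (hg' p w hw).2) l' l'',
    .test idx g' _ f hf l' l'' fun p x hpx hx => ?_,
    .test idx h g' _ l' l'' fun p w hw => hg p w (hg' p w hw).1⟩
  obtain ⟨⟨w, hw⟩, hval⟩ := hgf p x hpx hx
  obtain ⟨y, hy, rfl⟩ := hval w hw
  exact ⟨⟨_, ⟨y, hw, hf x y hy⟩, rfl⟩, fun w' hw' => hval w' (hg' p w' hw').1⟩

variable {P : GTM.{u, v, s} σ zero one k Z} {δ : ∀ i, MultiRep σ (Z i)}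

theorem GTM.IsComputable.exists_stmtRealizes_stmtApproximates [Finite σ] [Primcodable σ]
    (hP : P.IsComputable δ) (l : P.Lab) (hl : l ≠ P.lf) :
    ∃ S I, StmtRealizes δ S (P.stm l hl) ∧ StmtApproximates I S ∧ I.IsPrimrec := by
  have h := hP l hl
  cases hS : P.stm l hl with
  | right i l' => exact ⟨_, _, .right i l', .right i l', trivial⟩
  | left i l' => exact ⟨_, _, .left i l', .left i l', trivial⟩
  | write i a l' => exact ⟨_, _, .write i a l', .write i a l', trivial⟩
  | branch i a l' l'' => exact ⟨_, _, .branch i a l' l'', .branch i a l' l'', trivial⟩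
  | assign i idx f l' =>
    rw [hS] at h
    obtain ⟨g, hg, hgf⟩ := h
    obtain ⟨h, hh, hhg⟩ := hg.exists_approximates
    exact ⟨_, _, .assign i idx _ f l' hgf, .assign i idx h _ l' hhg, hh⟩
  | test idx f hf l' l'' =>
    rw [hS] at h
    obtain ⟨g, hg, hgf⟩ := h
    obtain ⟨h, hh, hhg⟩ := hg.exists_approximates
    obtain ⟨S, hS, hI⟩ := exists_stmtRealizes_test hf hgf hhg l' l''
    exact ⟨S, _, hS, hI, hh⟩

theorem GTM.IsContinuous.exists_stmtRealizes_stmtApproximates (hP : P.IsContinuous δ) (l : P.Lab)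
    (hl : l ≠ P.lf) :
    ∃ S I, StmtRealizes δ S (P.stm l hl) ∧ StmtApproximates I S := by
  have h := hP l hl
  cases hS : P.stm l hl with
  | right i l' => exact ⟨_, _, .right i l', .right i l'⟩
  | left i l' => exact ⟨_, _, .left i l', .left i l'⟩
  | write i a l' => exact ⟨_, _, .write i a l', .write i a l'⟩
  | branch i a l' l'' => exact ⟨_, _, .branch i a l' l'', .branch i a l' l''⟩
  | assign i idx f l' =>
    rw [hS] at h
    obtain ⟨g, hg, hgf⟩ := h
    obtain ⟨h, hhg⟩ := hg.exists_approximates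
    exact ⟨_, _, .assign i idx _ f l' hgf, .assign i idx h _ l' hhg⟩
  | test idx f hf l' l'' =>
    rw [hS] at h
    obtain ⟨g, hg, hgf⟩ := h
    obtain ⟨h, hhg⟩ := hg.exists_approximates
    obtain ⟨S, hS, hI⟩ := exists_stmtRealizes_test hf hgf hhg l' l''
    exact ⟨S, _, hS, hI⟩

theorem GTM.IsComputable.relComputable_fn [Finite σ] (h01 : zero ≠ one) (hP : P.IsComputable δ) :
    RelComputable (fun j => δ (P.inTape j)) (δ 0) P.fn := by
  have : Nonempty σ := ⟨zero⟩
  let _ := primcodableOfFinite σ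
  choose stm prog hstm hprog hprim using hP.exists_stmtRealizes_stmtApproximates
  have happrox := approximatesSeq_approxOutput (N := P.onNames stm) h01 hprog
  exact ⟨_, happrox.selection.computableToSeq (primrec_approxOutput hprim),
    (GTM.realizes_outputsFrom_initial hstm).selection⟩

theorem GTM.IsContinuous.relContinuous_fn (h01 : zero ≠ one) (hP : P.IsContinuous δ) :
    RelContinuous (fun j => δ (P.inTape j)) (δ 0) P.fn := by
  choose stm prog hstm hprog using hP.exists_stmtRealizes_stmtApproximates
  have happrox := approximatesSeq_approxOutput (N := P.onNames stm) h01 hprog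
  exact ⟨_, happrox.selection.continuousToSeq,
    (GTM.realizes_outputsFrom_initial hstm).selection⟩

end Closure

theorem theoremt4_general {σ : Type s} {zero one : σ} (h01 : zero ≠ one) {k L : ℕ}
    {Z : Fin (L + 1) → Type u} (P : GTM.{u, v, s} σ zero one k Z)
    (δ : ∀ i, MultiRep σ (Z i)) :
    (Finite σ → P.IsComputable δ → RelComputable (fun j => δ (P.inTape j)) (δ 0) P.fn) ∧
    (P.IsContinuous δ → RelContinuous (fun j => δ (P.inTape j)) (δ 0) P.fn) :=
  ⟨fun _ hP => hP.relComputable_fn h01, fun hP => hP.relContinuous_fn h01⟩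

/-- The functions on multi-represented sets that are relatively computable (relatively continuous)
are closed under programming with generalized Turing machines. -/
theorem theoremt4 {σ : Type s} [Finite σ] {zero one : σ} (h01 : zero ≠ one) {k L : ℕ}
    {Z : Fin (L + 1) → Type u} (P : GTM.{u, v, s} σ zero one k Z)
    (δ : ∀ i, MultiRep σ (Z i)) :
    (P.IsComputable δ → RelComputable (fun j => δ (P.inTape j)) (δ 0) P.fn) ∧
    (P.IsContinuous δ → RelContinuous (fun j => δ (P.inTape j)) (δ 0) P.fn) :=
  have general := theoremt4_general h01 P δ
  ⟨general.1 inferInstance, general.2⟩
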